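/- For complex numbers $A,B,C,D$ let $S=S_{(A,B,C,D)}\subset\mathbf{C}^3$ be the affine cubic surface $x^2+y^2+z^2+xyz=Ax+By+Cz+D$, let $\mathrm{Aut}[S]$ be its group of polynomial automorphisms (bijections of $S$ which, together with their inverses, are restrictions of polynomial maps of $\mathbf{C}^3$), and let $\mathcal{A}\subset\mathrm{Aut}[S]$ be the subgroup generated by the three involutions $$s_x(x,y,z)=(A-x-yz,\,y,\,z),\quad s_y(x,y,z)=(x,\,B-y-xz,\,z),\quad s_z(x,y,z)=(x,\,y,\,C-z-xy).$$ Let $\Gamma_2^*\subset \mathrm{PGL}(2,\mathbf{Z})$ be the group of classes of matrices congruent to the identity modulo $2$. It acts on the four punctured sphere $\mathbb{S}^2_4=(\mathbf{R}^2/\mathbf{Z}^2\setminus H)/\{\pm1\}$, where $H$ is the group of points of order dividing $2$ in the torus, and fixes the four punctures; this gives a morphism from $\Gamma_2^*$ to $\mathrm{Out}(\pi_1(\mathbb{S}^2_4))$, where $\pi_1(\mathbb{S}^2_4)=\langle\alpha,\beta,\gamma,\delta\mid\alpha\beta\gamma\delta=1\rangle$. Given a representation $\rho:\pi_1(\mathbb{S}^2_4)\to\mathrm{SL}(2,\mathbf{C})$,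 write $a,b,c,d$ for the traces of $\rho(\alpha),\rho(\beta),\rho(\gamma),\rho(\delta)$ and $(x,y,z)=(\mathrm{tr}\,\rho(\alpha\beta),\mathrm{tr}\,\rho(\beta\gamma),\mathrm{tr}\,\rho(\gamma\alpha))$; this is a point of $S_{(A,B,C,D)}$ for $A=ab+cd$, $B=bc+ad$, $C=ac+bd$, $D=4-a^2-b^2-c^2-d^2-abcd$. The group $\Gamma_2^*$ then acts on $S_{(A,B,C,D)}$ by polynomial automorphisms: if $M\in\Gamma_2^*$ acts on $\pi_1(\mathbb{S}^2_4)$ by $\Phi$ (up to inner automorphisms), then $M$ maps the point $(x,y,z)$ of $\rho$ to that of $\rho\circ\Phi^{-1}$. Theorem A. For every $(A,B,C,D)\in\mathbf{C}^4$: (1) there is no non-trivial relation between the involutions $s_x,s_y,s_z$: the morphism from the free product $\mathbf{Z}/2\mathbf{Z}*\mathbf{Z}/2\mathbf{Z}*\mathbf{Z}/2\mathbf{Z}$ to $\mathcal{A}$ sending the three generators to $s_x,s_y,s_z$ is an isomorphism; (2) the morphism $\Gamma_2^*\to\mathrm{Aut}[S_{(A,B,C,D)}]$ is injective and its image is $\mathcal{A}$;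 (3) $\mathcal{A}$ is a normal subgroup of $\mathrm{Aut}[S_{(A,B,C,D)}]$, of finite index at most $24$. Moreover, for a generic choice of $(A,B,C,D)$, namely for all parameters outside some proper Zariski closed subset of $\mathbf{C}^4$, $\mathcal{A}=\mathrm{Aut}[S_{(A,B,C,D)}]$. -/

import Mathlib

open scoped MatrixGroups

namespace CubicSurface

/-! The fundamental group of the four punctured sphere and its characters -/

/-- The relator `α β γ δ` on four letters (numbered `0, 1, 2, 3`). -/
def sphereRel : FreeGroup (Fin 4) :=
  FreeGroup.of 0 * FreeGroup.of 1 * FreeGroup.of 2 * FreeGroup.of 3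

/-- `π₁(𝕊²₄) = ⟨α, β, γ, δ | α β γ δ = 1⟩`. -/
abbrev SpherePi1 : Type := PresentedGroup ({sphereRel} : Set (FreeGroup (Fin 4)))

/-- The four loops `α, β, γ, δ` around the punctures. -/
def loop (i : Fin 4) : SpherePi1 := PresentedGroup.of i

/-- The set `Rep(𝕊²₄)` of representations into `SL(2, ℂ)`. -/
abbrev SphereRep : Type := SpherePi1 →* Matrix.SpecialLinearGroup (Fin 2) ℂ

/-- The trace of `ρ(g)`. -/
noncomputable def tr (ρ : SphereRep) (g : SpherePi1) : ℂ := (ρ g).1.trace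

/-- The coordinates `(x, y, z) = (tr ρ(αβ), tr ρ(βγ), tr ρ(γα))`. -/
noncomputable def charXYZ (ρ : SphereRep) : Fin 3 → ℂ :=
  ![tr ρ (loop 0 * loop 1), tr ρ (loop 1 * loop 2), tr ρ (loop 2 * loop 0)]

/-- The parameters `(A, B, C, D)` attached to a representation through its boundary traces
`a = tr ρ(α)`, `b = tr ρ(β)`, `c = tr ρ(γ)`, `d = tr ρ(δ)`. -/
noncomputable def charParams (ρ : SphereRep) : Fin 4 → ℂ :=
  let a := tr ρ (loop 0)
  let b := tr ρ (loop 1)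
  let c := tr ρ (loop 2)
  let d := tr ρ (loop 3)
  ![a * b + c * d, b * c + a * d, a * c + b * d,
    4 - a ^ 2 - b ^ 2 - c ^ 2 - d ^ 2 - a * b * c * d]

/-- `ρ ∘ Φ⁻¹` for an automorphism `Φ` of the fundamental group. -/
def repAct (Φ : MulAut SpherePi1) (ρ : SphereRep) : SphereRep :=
  ρ.comp (Φ⁻¹ : MulAut SpherePi1).toMonoidHom

/-! Outer automorphisms -/

/-- Inner automorphisms form a normal subgroup. -/
instance innerNormal (G : Type*) [Group G] : (MulAut.conj : G →* MulAut G).range.Normal where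
  conj_mem := by
    rintro _ ⟨g, rfl⟩ Φ
    refine ⟨Φ g, ?_⟩
    ext x
    simp [MulAut.conj_apply, MulAut.mul_apply]

/-- `Out(G) = Aut(G) / Inn(G)`. -/
abbrev Out (G : Type*) [Group G] : Type _ := MulAut G ⧸ (MulAut.conj : G →* MulAut G).range

/-! The modular group and the torus cover -/

/-- `Γ₂^*`: the classes in `PGL(2, ℤ)` of the matrices congruent to the identity modulo `2`. -/
def GammaTwoStar : Subgroup PGL(2, ℤ) :=
  (Matrix.GeneralLinearGroup.map (n := Fin 2) (Int.castRingHom (ZMod 2))).ker.map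
    Matrix.ProjGenLinGroup.mk

/-- Lifts to the plane of the four ramification points `p_α, p_β, p_γ, p_δ` of
`ℝ² / ℤ² → (ℝ² / ℤ²) / {±1} = 𝕊²`, in the cyclic order of the corners of the rectangle
`[0, 1/2] × [0, 1/2]`, two copies of which make up the sphere. -/
noncomputable def puncture : Fin 4 → (Fin 2 → ℝ) :=
  ![![1 / 2, 0], ![1 / 2, 1 / 2], ![0, 1 / 2], ![0, 0]]

/-- The complement of `½ ℤ²` in the plane is a Galois cover of `𝕊²₄`, with deck group
`{v ↦ ± v + n | n ∈ ℤ²}`. The action of `π₁(𝕊²₄)` on the plane through this deck group: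
the loop around a puncture acts by the half-turn about a lift of that puncture. -/
noncomputable def deck : SpherePi1 →* Equiv.Perm (Fin 2 → ℝ) :=
  PresentedGroup.toGroup (f := fun i => Equiv.pointReflection (puncture i)) (by
    rintro r rfl
    ext v i
    fin_cases i <;>
      simp [sphereRel, puncture, Equiv.pointReflection_apply, Matrix.vecHead, Matrix.vecTail])

/-- The linear action of `GL(2, ℤ)` on the plane. -/
noncomputable def linAct (N : GL (Fin 2) ℤ) (v : Fin 2 → ℝ) : Fin 2 → ℝ :=
  (N.1.map (Int.cast : ℤ → ℝ)).mulVec v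

/-- `Φ` is the action on `π₁(𝕊²₄)` (up to the choice of a path joining the base point to its
image) of the homeomorphism of `𝕊²₄ = (ℝ² / ℤ² ∖ H) / {±1}` induced by the linear map `N`,
where `N` is the identity modulo `2` and thus fixes every puncture: `Φ` maps a loop around a
puncture to a loop, run through in one of the two directions, around the same puncture, and
`deck g ∘ N`, for some `g`, is a lift to the plane which intertwines `w` and `Φ w` for
every `w` in `π₁(𝕊²₄)`. These two conditions determine `Φ` up to inner automorphisms. -/
structure IsInducedBy (N : GL (Fin 2) ℤ) (Φ : MulAut SpherePi1) : Prop where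
  peripheral : ∀ i, IsConj (Φ (loop i)) (loop i) ∨ IsConj (Φ (loop i)) (loop i)⁻¹
  equivariant : ∃ g : SpherePi1, ∀ (w : SpherePi1) (v : Fin 2 → ℝ),
    deck (Φ w) (deck g (linAct N v)) = deck g (linAct N (deck w v))

/-- `Ψ` is the morphism `Γ₂^* → Out(π₁(𝕊²₄))` given by the action of `Γ₂^*` on `𝕊²₄`. -/
def IsModularMorphism (Ψ : GammaTwoStar →* Out SpherePi1) : Prop :=
  ∀ (N : GL (Fin 2) ℤ) (hN : Matrix.ProjGenLinGroup.mk N ∈ GammaTwoStar) (Φ : MulAut SpherePi1),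
    Ψ ⟨Matrix.ProjGenLinGroup.mk N, hN⟩ = (Φ : Out SpherePi1) → IsInducedBy N Φ

/-! The cubic surfaces and their automorphisms -/

/-- The affine cubic surface `S_{(A,B,C,D)}` in `ℂ³`. -/
def surface (A B C D : ℂ) : Set (Fin 3 → ℂ) :=
  {p | p 0 ^ 2 + p 1 ^ 2 + p 2 ^ 2 + p 0 * p 1 * p 2 = A * p 0 + B * p 1 + C * p 2 + D}

/-- A self-map of a subset of `ℂ³` which is the restriction of a polynomial map. -/
def IsPolynomialMap {S : Set (Fin 3 → ℂ)} (f : S → S) : Prop :=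
  ∃ F : Fin 3 → MvPolynomial (Fin 3) ℂ, ∀ (p : S) (i : Fin 3),
    (f p : Fin 3 → ℂ) i = MvPolynomial.eval (p : Fin 3 → ℂ) (F i)

theorem IsPolynomialMap.comp {S : Set (Fin 3 → ℂ)} {f g : S → S} (hf : IsPolynomialMap f)
    (hg : IsPolynomialMap g) : IsPolynomialMap (f ∘ g) := by
  obtain ⟨F, hF⟩ := hf
  obtain ⟨G, hG⟩ := hg
  refine ⟨fun i => MvPolynomial.bind₁ G (F i), fun p i => ?_⟩
  have h : ((g p : S) : Fin 3 → ℂ) =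
      fun j => MvPolynomial.aeval (p : Fin 3 → ℂ) (G j) := by
    funext j
    rw [hG, MvPolynomial.aeval_eq_eval]
  change ((f (g p) : S) : Fin 3 → ℂ) i =
    MvPolynomial.eval (p : Fin 3 → ℂ) (MvPolynomial.bind₁ G (F i))
  rw [hF, ← MvPolynomial.aeval_eq_eval, ← MvPolynomial.aeval_eq_eval]
  rw [MvPolynomial.aeval_bind₁, h]

/-- The group `Aut[S]` of polynomial automorphisms of `S = S_{(A,B,C,D)}`. -/
def polyAut (A B C D : ℂ) : Subgroup (Equiv.Perm (surface A B C D)) where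
  carrier := {f | IsPolynomialMap f ∧ IsPolynomialMap f.symm}
  one_mem' := ⟨⟨MvPolynomial.X, fun _ _ => by simp⟩, ⟨MvPolynomial.X, fun p i => by
    rw [MvPolynomial.eval_X]; rfl⟩⟩
  mul_mem' := fun {f g} hf hg => ⟨hf.1.comp hg.1, hg.2.comp hf.2⟩
  inv_mem' := fun {f} hf => ⟨hf.2, hf.1⟩

/-- `s_x(x, y, z) = (A - x - yz, y, z)`. -/
def sX (A B C D : ℂ) : polyAut A B C D :=
  have hinv : Function.Involutive (fun p : surface A B C D =>
      (⟨![A - p.1 0 - p.1 1 * p.1 2, p.1 1, p.1 2], by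
        have h := p.2
        simp only [surface, Set.mem_ofPred_eq] at h
        simp [surface]
        linear_combination h⟩ : surface A B C D)) := by
    intro p
    ext i
    fin_cases i <;> (simp; try ring)
  ⟨hinv.toPerm, by
    have h : IsPolynomialMap hinv.toPerm :=
      ⟨![MvPolynomial.C A - MvPolynomial.X 0 - MvPolynomial.X 1 * MvPolynomial.X 2,
        MvPolynomial.X 1, MvPolynomial.X 2], fun p i => by fin_cases i <;> simp⟩
    exact ⟨h, h⟩⟩

/-- `s_y(x, y, z) = (x, B - y - xz, z)`. -/
def sY (A B C D : ℂ) : polyAut A B C D :=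
  have hinv : Function.Involutive (fun p : surface A B C D =>
      (⟨![p.1 0, B - p.1 1 - p.1 0 * p.1 2, p.1 2], by
        have h := p.2
        simp only [surface, Set.mem_ofPred_eq] at h
        simp [surface]
        linear_combination h⟩ : surface A B C D)) := by
    intro p
    ext i
    fin_cases i <;> (simp; try ring)
  ⟨hinv.toPerm, by
    have h : IsPolynomialMap hinv.toPerm :=
      ⟨![MvPolynomial.X 0, MvPolynomial.C B - MvPolynomial.X 1 -
        MvPolynomial.X 0 * MvPolynomial.X 2, MvPolynomial.X 2],
        fun p i => by fin_cases i <;> simp⟩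
    exact ⟨h, h⟩⟩

/-- `s_z(x, y, z) = (x, y, C - z - xy)`. -/
def sZ (A B C D : ℂ) : polyAut A B C D :=
  have hinv : Function.Involutive (fun p : surface A B C D =>
      (⟨![p.1 0, p.1 1, C - p.1 2 - p.1 0 * p.1 1], by
        have h := p.2
        simp only [surface, Set.mem_ofPred_eq] at h
        simp [surface]
        linear_combination h⟩ : surface A B C D)) := by
    intro p
    ext i
    fin_cases i <;> (simp; try ring)
  ⟨hinv.toPerm, by
    have h : IsPolynomialMap hinv.toPerm :=
      ⟨![MvPolynomial.X 0, MvPolynomial.X 1, MvPolynomial.C C - MvPolynomial.X 2 -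
        MvPolynomial.X 0 * MvPolynomial.X 1], fun p i => by fin_cases i <;> simp⟩
    exact ⟨h, h⟩⟩

/-- The three involutions `s_x, s_y, s_z`. -/
def involution (A B C D : ℂ) : Fin 3 → polyAut A B C D :=
  ![sX A B C D, sY A B C D, sZ A B C D]

/-- The subgroup `𝒜 = ⟨s_x, s_y, s_z⟩` of `Aut[S]`. -/
def involutionGroup (A B C D : ℂ) : Subgroup (polyAut A B C D) :=
  Subgroup.closure (Set.range (involution A B C D))

/-- The free product `ℤ/2 * ℤ/2 * ℤ/2`. -/
abbrev FreeProductZ2 : Type := Monoid.CoprodI (fun _ : Fin 3 => Multiplicative (ZMod 2))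

/-- The generator of the `i`-th free factor of `ℤ/2 * ℤ/2 * ℤ/2`. -/
def freeGen (i : Fin 3) : FreeProductZ2 :=
  Monoid.CoprodI.of (i := i) (Multiplicative.ofAdd (1 : ZMod 2))

/-- `Θ : Γ₂^* → Aut[S]` is the action on `S = S_{(A,B,C,D)}` obtained from the morphism
`Ψ : Γ₂^* → Out(π₁(𝕊²₄))`: if `Φ` represents `Ψ(M)`, then `Θ(M)` maps the character of `ρ` to
the character of `ρ ∘ Φ⁻¹`, for every `ρ` whose character is a point of `S`. -/
def IsInducedAction (A B C D : ℂ) (Ψ : GammaTwoStar →* Out SpherePi1)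
    (Θ : GammaTwoStar →* polyAut A B C D) : Prop :=
  ∀ (M : GammaTwoStar) (Φ : MulAut SpherePi1), Ψ M = (Φ : Out SpherePi1) →
    ∀ (ρ : SphereRep) (p : surface A B C D), charParams ρ = ![A, B, C, D] →
      (p : Fin 3 → ℂ) = charXYZ ρ →
      ((Θ M : Equiv.Perm (surface A B C D)) p : Fin 3 → ℂ) = charXYZ (repAct Φ ρ)

end CubicSurface

/-! Statements (1) and (2) rest on two ping-pong arguments. Near infinity on the surface, `s_x`
replaces x by a number of the size of yz, so x becomes dominant wherever y or z was
(`polyLift_injective`). On the projective line, each of three reflections of `Γ₂^*` exchanges one of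
three disjoint intervals with its complement (`mk_glLift_injective`), and a Euclidean algorithm
shows that they generate `Γ₂^*` (`range_mk_glLift`). Both groups are thus `ℤ/2 * ℤ/2 * ℤ/2`, and a
morphism out of `Γ₂^*` may be prescribed on the reflections. Each reflection lifts to an affine
reflection of the plane, which induces an explicit involution of the fundamental group
(`isInducedBy_refl`); trace identities in SL(2) show that it acts on characters by one of `s_x, s_y,
s_z` (`charXYZ_repAct_refl`).

For (3), polynomial functions are measured by their pole orders along the three lines in which the
closure of the cubic meets the plane at infinity. The ring of functions is free of rank 2 over ℂ[x,
y], and the order along a line is half the degree in y of the norm, hence additive on products; the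
point is that X² - 4 is not a square in ℂ(X) (`CubicRing.norm_ne_zero_and_natDegree`). For the
components of an automorphism, the equation of the surface forces the largest order to be the sum of
the other two. By Vieta's formula for the product of the roots, the corresponding involution lowers
it if the other two are positive. The descent stops at a component of order zero, which is a
polynomial in a single coordinate, and in fact affine in it (`exists_component_eq_linear`).

Treating the three lines in turn leaves an automorphism whose components are affine in distinct
coordinates. Comparing coefficients in the equation, it permutes the coordinates up to signs of
product 1 (`exists_isSignedPerm`). There are at most 6 · 4 = 24 such maps; they normalise `𝒜`, and
only the identity remains when A, B, C are non-zero with distinct squares. -/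

namespace CubicSurface

/-! Involutions and the free product `ℤ/2 * ℤ/2 * ℤ/2` -/

section FreeProduct

variable {G : Type*} [Group G]

/-- The morphism `ℤ/2 → G` defined by an involution of `G`. -/
def ofInvolution (g : G) (hg : g * g = 1) : Multiplicative (ZMod 2) →* G :=
  MonoidHom.mk' (fun m => if m = 1 then 1 else g) (by
    have key : ∀ a b : Multiplicative (ZMod 2),
        (a = 1 ∧ a * b = b) ∨ (b = 1 ∧ a * b = a) ∨ (a ≠ 1 ∧ b ≠ 1 ∧ a * b = 1) := by decide
    intro a b
    rcases key a b with ⟨h, h'⟩ | ⟨h, h'⟩ | ⟨h, h', h''⟩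
    · simp [h]
    · simp [h]
    · simp [h, h', h'', hg])

theorem ofInvolution_of_ne_one {g : G} {hg : g * g = 1} {m : Multiplicative (ZMod 2)}
    (hm : m ≠ 1) : ofInvolution g hg m = g := by
  simp [ofInvolution, hm]

/-- The morphism `ℤ/2 * ℤ/2 * ℤ/2 → G` defined by three involutions of `G`. -/
def freeLift (g : Fin 3 → G) (hg : ∀ i, g i * g i = 1) : FreeProductZ2 →* G :=
  Monoid.CoprodI.lift fun i => ofInvolution (g i) (hg i)

@[simp]
theorem freeLift_freeGen (g : Fin 3 → G) (hg : ∀ i, g i * g i = 1) (i : Fin 3) :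
    freeLift g hg (freeGen i) = g i := by
  rw [freeLift, freeGen, Monoid.CoprodI.lift_of, ofInvolution_of_ne_one (by decide)]

theorem freeProduct_induction {motive : FreeProductZ2 → Prop} (w : FreeProductZ2)
    (one : motive 1) (gen : ∀ i, motive (freeGen i))
    (mul : ∀ x y, motive x → motive y → motive (x * y)) : motive w := by
  induction w using Monoid.CoprodI.induction_on with
  | one => exact one
  | of i m =>
    have key : ∀ m : Multiplicative (ZMod 2), m = 1 ∨ m = Multiplicative.ofAdd 1 := by decide
    rcases key m with rfl | rfl
    · simpa using one
    · exact gen i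
  | mul x y hx hy => exact mul x y hx hy

theorem freeLift_range (g : Fin 3 → G) (hg : ∀ i, g i * g i = 1) :
    (freeLift g hg).range = Subgroup.closure (Set.range g) := by
  apply le_antisymm
  · rintro _ ⟨w, rfl⟩
    induction w using freeProduct_induction with
    | one => simp
    | gen i => simpa using Subgroup.subset_closure (Set.mem_range_self i)
    | mul x y hx hy => simpa using mul_mem hx hy
  · rw [Subgroup.closure_le]
    rintro _ ⟨i, rfl⟩
    exact ⟨freeGen i, by simp⟩

/-- The ping-pong lemma for three involutions. -/
theorem freeLift_injective {α : Type*} [MulAction G α] (g : Fin 3 → G) (hg : ∀ i, g i * g i = 1)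
    (X : Fin 3 → Set α) (hne : ∀ i, (X i).Nonempty)
    (hdisj : ∀ i j, i ≠ j → ∀ a ∈ X i, a ∉ X j)
    (hpp : ∀ i j, i ≠ j → ∀ a ∈ X j, g i • a ∈ X i) : Function.Injective (freeLift g hg) := by
  -- Ping-pong requires three factors, or a factor with at least three elements, which excludes `ℤ/2
  -- * ℤ/2`; here there are three factors.
  refine Monoid.CoprodI.lift_injective_of_ping_pong _ (Or.inl (by simp)) X hne ?_ ?_
  · intro i j hij
    exact Set.disjoint_left.mpr (hdisj i j hij)
  · rintro i j hij h hh _ ⟨a, ha, rfl⟩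
    simpa [ofInvolution_of_ne_one hh] using hpp i j hij a ha

end FreeProduct

/-! The three reflections generating `Γ₂^*` -/

/-- The linear parts of the three reflections, as integral matrices. -/
def reflMat : Fin 3 → Matrix (Fin 2) (Fin 2) ℤ :=
  ![!![1, 2; 0, -1], !![1, 0; -2, -1], !![-1, 0; 0, 1]]

theorem reflMat_mul_self (i : Fin 3) : reflMat i * reflMat i = 1 := by
  fin_cases i <;> decide

/-- The three reflections in `GL(2, ℤ)`. -/
def refl (i : Fin 3) : GL (Fin 2) ℤ :=
  ⟨reflMat i, reflMat i, reflMat_mul_self i, reflMat_mul_self i⟩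

theorem refl_mul_self (i : Fin 3) : refl i * refl i = 1 := Units.ext (reflMat_mul_self i)

/-- The morphism `ℤ/2 * ℤ/2 * ℤ/2 → GL(2, ℤ)` given by the three reflections. -/
def glLift : FreeProductZ2 →* GL (Fin 2) ℤ := freeLift refl refl_mul_self

/-- The action of `GL(2, ℤ)` on bilinear forms. -/
def formAct : GL (Fin 2) ℤ →* Equiv.Perm (Matrix (Fin 2) (Fin 2) ℤ) :=
  MonoidHom.toHomPerm
    { toFun := fun N Q => N.1 * Q * N.1.transpose
      map_one' := by
        funext Q
        change _ = Q
        simp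
      map_mul' := by
        intro N N'
        funext Q
        change _ = N.1 * (N'.1 * Q * N'.1.transpose) * N.1.transpose
        simp [Matrix.transpose_mul, Matrix.mul_assoc] }

theorem formAct_apply (N : GL (Fin 2) ℤ) (Q : Matrix (Fin 2) (Fin 2) ℤ) :
    formAct N Q = N.1 * Q * N.1.transpose := rfl

/-- The center is {±1}, and signs cancel in N Q Nᵗ. This is why slopes are encoded by the forms v vᵗ
rather than by vectors: the action factors through PGL(2, ℤ). -/
theorem formAct_eq_one_of_mem_center {N : GL (Fin 2) ℤ} (hN : N ∈ Subgroup.center (GL (Fin 2) ℤ)) :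
    formAct N = 1 := by
  rw [Matrix.GeneralLinearGroup.center_eq_range_scalar] at hN
  obtain ⟨u, rfl⟩ := hN
  ext Q i j
  rcases Int.units_eq_one_or u with rfl | rfl
  · simp
  · simp [formAct_apply]

/-- The squares of the vectors whose slope is in one of the three intervals cut out on the
projective line by the three reflections. -/
def slopeSet : Fin 3 → Set (Matrix (Fin 2) (Fin 2) ℤ) :=
  ![{Q | ∃ p q : ℤ, Q = !![p * p, p * q; q * p, q * q] ∧ q * (p + q) < 0},
    {Q | ∃ p q : ℤ, Q = !![p * p, p * q; q * p, q * q] ∧ p * (p + q) < 0},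
    {Q | ∃ p q : ℤ, Q = !![p * p, p * q; q * p, q * q] ∧ 0 < p * q}]

/-- With r = -(p + q), the three intervals are qr > 0, pr > 0 and pq > 0. No two of these hold
together, since p, q, r would have the same sign while p + q + r = 0; so on one interval the other
two products are negative. The `i`-th reflection changes the sign of the `i`-th product, which is
ping-pong. -/
theorem formAct_glLift_injective : Function.Injective (formAct.comp glLift) := by
  have hcomp : formAct.comp glLift = freeLift (fun i => formAct (refl i))
      (fun i => by rw [← map_mul, refl_mul_self, map_one]) := by
    refine MonoidHom.ext fun w => ?_
    induction w using freeProduct_induction with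
    | one => simp
    | gen i => simp [glLift]
    | mul x y hx hy => rw [map_mul, map_mul, hx, hy]
  rw [hcomp]
  -- The conditions on (p, q) depend only on the entries of the form, so two vectors representing
  -- the same form can be compared.
  have hsq : ∀ {p q : ℤ} {Q : Matrix (Fin 2) (Fin 2) ℤ},
      Q = !![p * p, p * q; q * p, q * q] → p * p = Q 0 0 ∧ p * q = Q 0 1 ∧ q * q = Q 1 1 := by
    rintro p q Q rfl
    simp
  refine freeLift_injective _ _ slopeSet ?_ ?_ ?_
  · intro i
    fin_cases i
    · exact ⟨_, 2, -1, rfl, by norm_num⟩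
    · exact ⟨_, 1, -2, rfl, by norm_num⟩
    · exact ⟨_, 1, 1, rfl, by norm_num⟩
  · intro i j hij Q hi hj
    fin_cases i <;> fin_cases j <;> first | exact absurd rfl hij | skip
    all_goals
      obtain ⟨p, q, hQ, h⟩ := hi
      obtain ⟨p', q', hQ', h'⟩ := hj
      have e := hsq hQ
      have e' := hsq hQ'
      nlinarith [mul_self_nonneg (p + q), mul_self_nonneg p, mul_self_nonneg q]
  · intro i j hij Q hj
    fin_cases i <;> fin_cases j <;> first | exact absurd rfl hij | skip
    all_goals obtain ⟨p, q, rfl, h⟩ := hj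
    · exact ⟨p + 2 * q, -q, by
        ext i j
        fin_cases i <;> fin_cases j <;>
          simp [formAct_apply, refl, reflMat, Matrix.mul_apply, Fin.sum_univ_two] <;> ring,
        by nlinarith [mul_self_nonneg (p + q), mul_self_nonneg p, mul_self_nonneg q]⟩
    · exact ⟨p + 2 * q, -q, by
        ext i j
        fin_cases i <;> fin_cases j <;>
          simp [formAct_apply, refl, reflMat, Matrix.mul_apply, Fin.sum_univ_two] <;> ring,
        by nlinarith [mul_self_nonneg (p + q), mul_self_nonneg p, mul_self_nonneg q]⟩
    · exact ⟨p, -2 * p - q, by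
        ext i j
        fin_cases i <;> fin_cases j <;>
          simp [formAct_apply, refl, reflMat, Matrix.mul_apply, Fin.sum_univ_two] <;> ring,
        by nlinarith [mul_self_nonneg (p + q), mul_self_nonneg p, mul_self_nonneg q]⟩
    · exact ⟨p, -2 * p - q, by
        ext i j
        fin_cases i <;> fin_cases j <;>
          simp [formAct_apply, refl, reflMat, Matrix.mul_apply, Fin.sum_univ_two] <;> ring,
        by nlinarith [mul_self_nonneg (p + q), mul_self_nonneg p, mul_self_nonneg q]⟩
    · exact ⟨-p, q, by
        ext i j
        fin_cases i <;> fin_cases j <;>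
          simp [formAct_apply, refl, reflMat, Matrix.mul_apply, Fin.sum_univ_two],
        by nlinarith [mul_self_nonneg (p + q), mul_self_nonneg p, mul_self_nonneg q]⟩
    · exact ⟨-p, q, by
        ext i j
        fin_cases i <;> fin_cases j <;>
          simp [formAct_apply, refl, reflMat, Matrix.mul_apply, Fin.sum_univ_two],
        by nlinarith [mul_self_nonneg (p + q), mul_self_nonneg p, mul_self_nonneg q]⟩

theorem mk_glLift_injective :
    Function.Injective ((Matrix.ProjGenLinGroup.mk (n := Fin 2) (R := ℤ)).comp glLift) := by
  rw [injective_iff_map_eq_one]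
  intro w hw
  apply (injective_iff_map_eq_one _).mp formAct_glLift_injective
  rw [MonoidHom.comp_apply, Matrix.ProjGenLinGroup.mk_eq_one] at hw
  exact formAct_eq_one_of_mem_center hw

/-- The kernel of reduction modulo `2`, as congruences on the entries. -/
theorem mem_ker_map_iff (N : GL (Fin 2) ℤ) :
    N ∈ (Matrix.GeneralLinearGroup.map (n := Fin 2) (Int.castRingHom (ZMod 2))).ker ↔
      ¬ Even (N.1 0 0) ∧ Even (N.1 0 1) ∧ Even (N.1 1 0) ∧ ¬ Even (N.1 1 1) := by
  have key : ∀ n : ℤ, (n : ZMod 2) = 1 ↔ ¬ Even n := by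
    intro n
    rw [Int.not_even_iff_odd, ZMod.intCast_eq_one_iff_odd]
  rw [MonoidHom.mem_ker]
  constructor
  · intro h
    have h' : ∀ i j, ((N.1 i j : ℤ) : ZMod 2) = (1 : Matrix (Fin 2) (Fin 2) (ZMod 2)) i j := by
      intro i j
      have := congrArg (fun M : GL (Fin 2) (ZMod 2) => M.1 i j) h
      simpa using this
    refine ⟨(key _).mp (by simpa using h' 0 0), ?_, ?_, (key _).mp (by simpa using h' 1 1)⟩
    · exact ZMod.intCast_eq_zero_iff_even.mp (by simpa using h' 0 1)
    · exact ZMod.intCast_eq_zero_iff_even.mp (by simpa using h' 1 0)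
  · rintro ⟨h1, h2, h3, h4⟩
    ext i j
    fin_cases i <;> fin_cases j
    · simpa using (key _).mpr h1
    · simpa using ZMod.intCast_eq_zero_iff_even.mpr h2
    · simpa using ZMod.intCast_eq_zero_iff_even.mpr h3
    · simpa using (key _).mpr h4

/-! ### Generation of `Γ₂^*` by a Euclidean algorithm -/

theorem refl_mem_ker (i : Fin 3) :
    refl i ∈ (Matrix.GeneralLinearGroup.map (n := Fin 2) (Int.castRingHom (ZMod 2))).ker := by
  rw [mem_ker_map_iff]
  fin_cases i <;> simp [refl, reflMat]

theorem refl_zero_mul (N : GL (Fin 2) ℤ) : (refl 0 * N).1 =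
    !![N.1 0 0 + 2 * N.1 1 0, N.1 0 1 + 2 * N.1 1 1; -N.1 1 0, -N.1 1 1] := by
  ext i j
  fin_cases i <;> fin_cases j <;> simp [refl, reflMat, Matrix.mul_apply, Fin.sum_univ_two]

theorem refl_one_mul (N : GL (Fin 2) ℤ) : (refl 1 * N).1 =
    !![N.1 0 0, N.1 0 1; -2 * N.1 0 0 - N.1 1 0, -2 * N.1 0 1 - N.1 1 1] := by
  ext i j
  fin_cases i <;> fin_cases j <;>
    simp [refl, reflMat, Matrix.mul_apply, Fin.sum_univ_two, sub_eq_add_neg]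

theorem refl_two_mul (N : GL (Fin 2) ℤ) : (refl 2 * N).1 =
    !![-N.1 0 0, -N.1 0 1; N.1 1 0, N.1 1 1] := by
  ext i j
  fin_cases i <;> fin_cases j <;> simp [refl, reflMat, Matrix.mul_apply, Fin.sum_univ_two]

theorem mk_mem_of_refl_mul {N : GL (Fin 2) ℤ} (i : Fin 3)
    (h : Matrix.ProjGenLinGroup.mk (refl i * N) ∈
      ((Matrix.ProjGenLinGroup.mk (n := Fin 2) (R := ℤ)).comp glLift).range) :
    Matrix.ProjGenLinGroup.mk N ∈
      ((Matrix.ProjGenLinGroup.mk (n := Fin 2) (R := ℤ)).comp glLift).range := by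
  rw [map_mul] at h
  refine (Subgroup.mul_mem_cancel_left _ ?_).mp h
  exact ⟨freeGen i, by simp [glLift]⟩

/-- Upper triangular matrices congruent to the identity modulo `2` are, up to sign, products of
the three reflections. -/
theorem mk_mem_range_of_upper (n : ℕ) : ∀ N : GL (Fin 2) ℤ,
    N ∈ (Matrix.GeneralLinearGroup.map (n := Fin 2) (Int.castRingHom (ZMod 2))).ker →
    N.1 1 0 = 0 → (N.1 0 1).natAbs = n → Matrix.ProjGenLinGroup.mk N ∈
      ((Matrix.ProjGenLinGroup.mk (n := Fin 2) (R := ℤ)).comp glLift).range := by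
  induction n using Nat.strong_induction_on with
  | _ n ih =>
    intro N hN hc hb
    have hdet : IsUnit (N.1 0 0 * N.1 1 1) := by
      have := (Matrix.isUnit_iff_isUnit_det _).mp N.isUnit
      rwa [Matrix.det_fin_two, hc, mul_zero, sub_zero] at this
    have ha := Int.isUnit_iff.mp (isUnit_of_mul_isUnit_left hdet)
    have hd := Int.isUnit_iff.mp (isUnit_of_mul_isUnit_right hdet)
    have hpar := (mem_ker_map_iff N).mp hN
    obtain ⟨k, hk⟩ := hpar.2.1
    by_cases hb0 : N.1 0 1 = 0
    · have hcases : ∀ d : ℤ, N.1 0 0 = d → N.1 1 1 = d → Matrix.ProjGenLinGroup.mk N = 1 := by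
        intro d h h'
        rw [Matrix.ProjGenLinGroup.mk_eq_one,
          Matrix.GeneralLinearGroup.mem_center_iff_val_mem_range_scalar]
        refine ⟨d, ?_⟩
        ext i j
        rw [Matrix.scalar_apply]
        fin_cases i <;> fin_cases j <;> simp [hc, hb0, h, h']
      have hcases' : ∀ d : ℤ, N.1 0 0 = -d → N.1 1 1 = d →
          Matrix.ProjGenLinGroup.mk (refl 2 * N) = 1 := by
        intro d h h'
        rw [Matrix.ProjGenLinGroup.mk_eq_one,
          Matrix.GeneralLinearGroup.mem_center_iff_val_mem_range_scalar]
        refine ⟨d, ?_⟩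
        rw [refl_two_mul]
        ext i j
        rw [Matrix.scalar_apply]
        fin_cases i <;> fin_cases j <;> simp [hc, hb0, h, h']
      rcases ha with ha | ha <;> rcases hd with hd | hd
      · rw [hcases 1 ha hd]; exact one_mem _
      · apply mk_mem_of_refl_mul 2
        rw [hcases' (-1) (by simpa using ha) hd]; exact one_mem _
      · apply mk_mem_of_refl_mul 2
        rw [hcases' 1 ha hd]; exact one_mem _
      · rw [hcases (-1) ha hd]; exact one_mem _
    · have hker := mul_mem (refl_mem_ker 0) hN
      have hker' := mul_mem (refl_mem_ker 0) (mul_mem (refl_mem_ker 2) hN)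
      -- The diagonal entry d is ±1 and the corner b is even and non-zero. `refl 0` changes b into b
      -- + 2d, which is smaller in absolute value when bd < 0; otherwise `refl 2` first changes the
      -- sign of b.
      by_cases hs : N.1 0 1 * N.1 1 1 < 0
      · apply mk_mem_of_refl_mul 0
        refine ih _ ?_ _ hker ?_ rfl
        · rw [refl_zero_mul]
          simp only [Matrix.of_apply, Matrix.cons_val', Matrix.cons_val_zero, Matrix.cons_val_one]
          rcases hd with hd | hd <;> rw [hd] at hs ⊢ <;> omega
        · rw [refl_zero_mul]; simp [hc]
      · apply mk_mem_of_refl_mul 2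
        apply mk_mem_of_refl_mul 0
        refine ih _ ?_ _ hker' ?_ rfl
        · rw [refl_zero_mul, refl_two_mul]
          simp only [Matrix.of_apply, Matrix.cons_val', Matrix.cons_val_zero, Matrix.cons_val_one]
          rcases hd with hd | hd <;> rw [hd] at hs ⊢ <;> omega
        · rw [refl_zero_mul, refl_two_mul]; simp [hc]

/-- Euclid's algorithm on the first column (a, c), with a odd and c even, so that |a| ≠ |c|. `refl
2` makes the signs of a and c opposite; then a ↦ a + 2c (`refl 0`) or c ↦ -2a - c (`refl 1`) lowers
|a| + |c|, according to which entry is larger. The descent ends at c = 0. -/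
theorem mk_mem_range_of_mem_ker (n : ℕ) : ∀ N : GL (Fin 2) ℤ,
    N ∈ (Matrix.GeneralLinearGroup.map (n := Fin 2) (Int.castRingHom (ZMod 2))).ker →
    (N.1 0 0).natAbs + (N.1 1 0).natAbs = n → Matrix.ProjGenLinGroup.mk N ∈
      ((Matrix.ProjGenLinGroup.mk (n := Fin 2) (R := ℤ)).comp glLift).range := by
  induction n using Nat.strong_induction_on with
  | _ n ih =>
    intro N hN hn
    by_cases hc : N.1 1 0 = 0
    · exact mk_mem_range_of_upper _ N hN hc rfl
    obtain ⟨ha, -, ⟨k, hk⟩, -⟩ := (mem_ker_map_iff N).mp hN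
    rw [Int.not_even_iff_odd] at ha
    obtain ⟨l, hl⟩ := ha
    have step : ∀ N' : GL (Fin 2) ℤ,
        N' ∈ (Matrix.GeneralLinearGroup.map (n := Fin 2) (Int.castRingHom (ZMod 2))).ker →
        (N'.1 0 0).natAbs + (N'.1 1 0).natAbs = n → N'.1 0 0 % 2 = 1 → N'.1 1 0 % 2 = 0 →
        (N'.1 0 0 < 0 ∧ 0 < N'.1 1 0 ∨ 0 < N'.1 0 0 ∧ N'.1 1 0 < 0) →
        Matrix.ProjGenLinGroup.mk N' ∈
          ((Matrix.ProjGenLinGroup.mk (n := Fin 2) (R := ℤ)).comp glLift).range := by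
      intro N' hN' hn' h1 h2 hsign
      by_cases hlt : (N'.1 0 0).natAbs < (N'.1 1 0).natAbs
      · apply mk_mem_of_refl_mul 1
        refine ih _ ?_ _ (mul_mem (refl_mem_ker 1) hN') rfl
        rw [refl_one_mul]
        simp only [Matrix.of_apply, Matrix.cons_val', Matrix.cons_val_zero, Matrix.cons_val_one]
        omega
      · apply mk_mem_of_refl_mul 0
        refine ih _ ?_ _ (mul_mem (refl_mem_ker 0) hN') rfl
        rw [refl_zero_mul]
        simp only [Matrix.of_apply, Matrix.cons_val', Matrix.cons_val_zero, Matrix.cons_val_one]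
        omega
    by_cases hsign : N.1 0 0 < 0 ∧ 0 < N.1 1 0 ∨ 0 < N.1 0 0 ∧ N.1 1 0 < 0
    · exact step N hN hn (by omega) (by omega) hsign
    · apply mk_mem_of_refl_mul 2
      refine step _ (mul_mem (refl_mem_ker 2) hN) ?_ ?_ ?_ ?_ <;> rw [refl_two_mul] <;>
        simp only [Matrix.of_apply, Matrix.cons_val', Matrix.cons_val_zero,
          Matrix.cons_val_one] <;> omega

theorem range_mk_glLift :
    ((Matrix.ProjGenLinGroup.mk (n := Fin 2) (R := ℤ)).comp glLift).range = GammaTwoStar := by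
  apply le_antisymm
  · rintro _ ⟨w, rfl⟩
    refine ⟨glLift w, ?_, rfl⟩
    induction w using freeProduct_induction with
    | one => simp
    | gen i => simpa [glLift] using refl_mem_ker i
    | mul x y hx hy => rw [map_mul]; exact mul_mem hx hy
  · rintro _ ⟨N, hN, rfl⟩
    exact mk_mem_range_of_mem_ker _ N hN rfl

/-- `Γ₂^*` is the free product of the groups generated by the three reflections. -/
noncomputable def freeEquivGammaTwoStar : FreeProductZ2 ≃* GammaTwoStar :=
  (MonoidHom.ofInjective mk_glLift_injective).trans (MulEquiv.subgroupCongr range_mk_glLift)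

/-! Three involutions of the fundamental group -/

theorem loop_relation : loop 0 * loop 1 * loop 2 * loop 3 = 1 :=
  PresentedGroup.one_of_mem (rels := {sphereRel}) rfl

theorem loop_three : loop 3 = (loop 0 * loop 1 * loop 2)⁻¹ :=
  eq_inv_of_mul_eq_one_right loop_relation

theorem spherePi1_hom_ext {G : Type*} [Group G] {f g : SpherePi1 →* G}
    (h : ∀ i : Fin 3, f (loop i.castSucc) = g (loop i.castSucc)) : f = g := by
  have h0 : f (loop 0) = g (loop 0) := h 0
  have h1 : f (loop 1) = g (loop 1) := h 1
  have h2 : f (loop 2) = g (loop 2) := h 2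
  refine PresentedGroup.ext fun i => ?_
  change f (loop i) = g (loop i)
  fin_cases i
  · exact h0
  · exact h1
  · exact h2
  · simp [loop_three, h0, h1, h2]

/-- The endomorphism of `π₁(𝕊²₄)` mapping `α, β, γ` to given elements. -/
def spherePi1Lift (g : Fin 3 → SpherePi1) : SpherePi1 →* SpherePi1 :=
  PresentedGroup.toGroup (f := ![g 0, g 1, g 2, (g 0 * g 1 * g 2)⁻¹]) (by
    rintro r rfl
    simp [sphereRel])

@[simp]
theorem spherePi1Lift_zero (g : Fin 3 → SpherePi1) : spherePi1Lift g (loop 0) = g 0 :=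
  PresentedGroup.toGroup.of _

@[simp]
theorem spherePi1Lift_one (g : Fin 3 → SpherePi1) : spherePi1Lift g (loop 1) = g 1 :=
  PresentedGroup.toGroup.of _

@[simp]
theorem spherePi1Lift_two (g : Fin 3 → SpherePi1) : spherePi1Lift g (loop 2) = g 2 :=
  PresentedGroup.toGroup.of _

@[simp]
theorem spherePi1Lift_three (g : Fin 3 → SpherePi1) :
    spherePi1Lift g (loop 3) = (g 0 * g 1 * g 2)⁻¹ :=
  PresentedGroup.toGroup.of _

/-- The images of `α, β, γ` under the involutions of `π₁(𝕊²₄)` induced by the reflections. -/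
def reflImage : Fin 3 → Fin 3 → SpherePi1 :=
  ![![loop 2 * (loop 0)⁻¹ * (loop 2)⁻¹, (loop 1)⁻¹, (loop 2)⁻¹],
    ![(loop 0)⁻¹, loop 0 * (loop 1)⁻¹ * (loop 0)⁻¹, (loop 2)⁻¹],
    ![(loop 0)⁻¹, (loop 1)⁻¹, loop 1 * (loop 2)⁻¹ * (loop 1)⁻¹]]

theorem spherePi1Lift_reflImage_comp_self (i : Fin 3) :
    (spherePi1Lift (reflImage i)).comp (spherePi1Lift (reflImage i)) = MonoidHom.id _ := by
  refine spherePi1_hom_ext fun j => ?_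
  fin_cases i <;> fin_cases j <;> simp [reflImage]

/-- The involutions of `π₁(𝕊²₄)` induced by the reflections. -/
def reflAut (i : Fin 3) : MulAut SpherePi1 :=
  MonoidHom.toMulEquiv _ _ (spherePi1Lift_reflImage_comp_self i)
    (spherePi1Lift_reflImage_comp_self i)

theorem reflAut_apply (i : Fin 3) (w : SpherePi1) :
    reflAut i w = spherePi1Lift (reflImage i) w := rfl

theorem reflAut_mul_self (i : Fin 3) : reflAut i * reflAut i = 1 := by
  ext w
  exact DFunLike.congr_fun (spherePi1Lift_reflImage_comp_self i) w

/-- The morphism `ℤ/2 * ℤ/2 * ℤ/2 → Aut(π₁(𝕊²₄))` given by the three involutions. -/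
def autLift : FreeProductZ2 →* MulAut SpherePi1 := freeLift reflAut reflAut_mul_self

theorem reflAut_peripheral (i : Fin 3) (j : Fin 4) :
    IsConj (reflAut i (loop j)) (loop j)⁻¹ := by
  have hconj : ∀ {a b : SpherePi1} (g : SpherePi1), a = g * b * g⁻¹ → IsConj a b := by
    intro a b g h
    exact isConj_iff.mpr ⟨g⁻¹, by rw [h]; group⟩
  fin_cases i <;> fin_cases j <;> rw [reflAut_apply]
  · exact hconj (loop 2) (by simp [reflImage])
  · exact hconj 1 (by simp [reflImage])
  · exact hconj 1 (by simp [reflImage])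
  · exact hconj (loop 2 * (loop 0)⁻¹) (by simp [reflImage, loop_three]; group)
  · exact hconj 1 (by simp [reflImage])
  · exact hconj (loop 0) (by simp [reflImage])
  · exact hconj 1 (by simp [reflImage])
  · exact hconj (loop 2) (by simp [reflImage, loop_three]; group)
  · exact hconj 1 (by simp [reflImage])
  · exact hconj 1 (by simp [reflImage])
  · exact hconj (loop 1) (by simp [reflImage])
  · exact hconj (loop 0)⁻¹ (by simp [reflImage, loop_three]; group)

/-! Lifts to the plane -/

theorem deck_loop (i : Fin 4) (v : Fin 2 → ℝ) :
    deck (loop i) v = puncture i - v + puncture i := by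
  have : deck (loop i) = Equiv.pointReflection (puncture i) := PresentedGroup.toGroup.of _
  rw [this, Equiv.pointReflection_apply]
  simp [vsub_eq_sub, vadd_eq_add]

theorem deck_loop_inv (i : Fin 4) (v : Fin 2 → ℝ) :
    deck (loop i)⁻¹ v = puncture i - v + puncture i := by
  rw [map_inv, Equiv.Perm.inv_eq_iff_eq, deck_loop]
  abel

theorem linAct_mul (N N' : GL (Fin 2) ℤ) (v : Fin 2 → ℝ) :
    linAct (N * N') v = linAct N (linAct N' v) := by
  simp only [linAct, Matrix.mulVec_mulVec, Units.val_mul]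
  congr 1
  exact Matrix.map_mul (f := Int.castRingHom ℝ)

theorem linAct_eq (N : GL (Fin 2) ℤ) (v : Fin 2 → ℝ) :
    linAct N v = ![N.1 0 0 * v 0 + N.1 0 1 * v 1, N.1 1 0 * v 0 + N.1 1 1 * v 1] := by
  funext i
  fin_cases i <;> simp [linAct, Matrix.mulVec, dotProduct, Fin.sum_univ_two]

theorem linAct_one (v : Fin 2 → ℝ) : linAct 1 v = v := by
  simp [linAct]

theorem linAct_neg (N : GL (Fin 2) ℤ) (v : Fin 2 → ℝ) : linAct (-N) v = -linAct N v := by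
  funext i
  fin_cases i <;> simp [linAct, Matrix.mulVec, dotProduct, Fin.sum_univ_two, add_comm]

theorem deck_loop_three (v : Fin 2 → ℝ) : deck (loop 3) v = -v := by
  rw [deck_loop]
  funext i
  fin_cases i <;> simp [puncture, Matrix.vecHead, Matrix.vecTail]

theorem isInducedBy_one : IsInducedBy 1 1 where
  peripheral i := Or.inl (IsConj.refl _)
  equivariant := ⟨1, fun w v => by simp [linAct_one]⟩

/-- The composite of the lifts `deck g ∘ N` and `deck g' ∘ N'` is again a lift: equivariance moves
`deck g'` across N, where it becomes `deck (Φ g')`. -/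
theorem IsInducedBy.mul {N N' : GL (Fin 2) ℤ} {Φ Φ' : MulAut SpherePi1}
    (h : IsInducedBy N Φ) (h' : IsInducedBy N' Φ') : IsInducedBy (N * N') (Φ * Φ') where
  peripheral i := by
    have hmap : ∀ {a b : SpherePi1}, IsConj a b → IsConj (Φ a) (Φ b) :=
      fun hab => Φ.toMonoidHom.map_isConj hab
    have hinv : ∀ {a b : SpherePi1}, IsConj a b → IsConj a⁻¹ b⁻¹ := by
      intro a b hab
      obtain ⟨c, rfl⟩ := isConj_iff.mp hab
      exact isConj_iff.mpr ⟨c, by group⟩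
    rw [MulAut.mul_apply]
    rcases h'.peripheral i with hi | hi
    · rcases h.peripheral i with hj | hj
      · exact Or.inl ((hmap hi).trans hj)
      · exact Or.inr ((hmap hi).trans hj)
    · have := hmap hi
      rw [map_inv] at this
      rcases h.peripheral i with hj | hj
      · exact Or.inr (this.trans (hinv hj))
      · exact Or.inl (by simpa using this.trans (hinv hj))
  equivariant := by
    obtain ⟨g, hg⟩ := h.equivariant
    obtain ⟨g', hg'⟩ := h'.equivariant
    have key : ∀ v, deck (Φ g' * g) (linAct (N * N') v) =
        deck g (linAct N (deck g' (linAct N' v))) := by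
      intro v
      rw [map_mul, Equiv.Perm.mul_apply, linAct_mul, hg]
    refine ⟨Φ g' * g, fun w v => ?_⟩
    rw [key, key, MulAut.mul_apply, hg, hg']

/-- Composing with an inner automorphism amounts to precomposing the lift with a deck
transformation. -/
theorem IsInducedBy.mul_conj {N : GL (Fin 2) ℤ} {Φ : MulAut SpherePi1}
    (h : IsInducedBy N Φ) (u : SpherePi1) : IsInducedBy N (Φ * MulAut.conj u) where
  peripheral i := by
    have : IsConj ((Φ * MulAut.conj u) (loop i)) (Φ (loop i)) :=
      Φ.toMonoidHom.map_isConj (isConj_iff.mpr ⟨u⁻¹, by simp [mul_assoc]⟩)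
    exact (h.peripheral i).imp this.trans this.trans
  equivariant := by
    obtain ⟨g, hg⟩ := h.equivariant
    refine ⟨Φ u * g, fun w v => ?_⟩
    have key : ∀ v, deck (Φ u * g) (linAct N v) = deck g (linAct N (deck u v)) := by
      intro v
      rw [map_mul, Equiv.Perm.mul_apply, hg]
    rw [key, key, MulAut.mul_apply, hg]
    simp [MulAut.conj_apply]

/-- Since -1 is the half-turn about the lift 0 of the fourth puncture, N and -N have the same lifts.
-/
theorem IsInducedBy.neg {N : GL (Fin 2) ℤ} {Φ : MulAut SpherePi1}
    (h : IsInducedBy N Φ) : IsInducedBy (-N) Φ where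
  peripheral := h.peripheral
  equivariant := by
    obtain ⟨g, hg⟩ := h.equivariant
    refine ⟨g * loop 3, fun w v => ?_⟩
    have key : ∀ v, deck (g * loop 3) (linAct (-N) v) = deck g (linAct N v) := by
      intro v
      rw [map_mul, Equiv.Perm.mul_apply, deck_loop_three, linAct_neg, neg_neg]
    rw [key, key, hg]

theorem equivariant_of_loops {Φ : MulAut SpherePi1} {T : (Fin 2 → ℝ) → Fin 2 → ℝ}
    (h : ∀ (i : Fin 3) v, deck (Φ (loop i.castSucc)) (T v) = T (deck (loop i.castSucc) v))
    (w : SpherePi1) : ∀ v, deck (Φ w) (T v) = T (deck w v) := by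
  let H : Subgroup SpherePi1 :=
    { carrier := {w | ∀ v, deck (Φ w) (T v) = T (deck w v)}
      one_mem' := fun v => by simp
      mul_mem' := fun {a b} ha hb v => by
        rw [map_mul, map_mul, map_mul, Equiv.Perm.mul_apply, Equiv.Perm.mul_apply, hb, ha]
      inv_mem' := fun {a} ha v => by
        rw [map_inv, map_inv, map_inv, Equiv.Perm.inv_eq_iff_eq, ha,
          ← Equiv.Perm.mul_apply, mul_inv_cancel, Equiv.Perm.one_apply] }
  have h3 : ∀ i : Fin 3, loop i.castSucc ∈ H := h
  refine PresentedGroup.generated_by _ H (fun i => ?_) w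
  change loop i ∈ H
  fin_cases i
  · exact h3 0
  · exact h3 1
  · exact h3 2
  · have := inv_mem (mul_mem (mul_mem (h3 0) (h3 1)) (h3 2))
    change loop 3 ∈ H
    rwa [loop_three]

theorem isInducedBy_refl (i : Fin 3) : IsInducedBy (refl i) (reflAut i) where
  peripheral j := Or.inr (reflAut_peripheral i j)
  equivariant := by
    -- These words act by the translations by (-1, 1), (0, 1) and (1, 0). They turn the linear
    -- reflection into an affine one fixing the chosen lifts of two of the punctures α, β, γ: the
    -- loops there are inverted, and the third is inverted and conjugated.
    refine ⟨![loop 2 * loop 0, loop 2 * loop 3, loop 0 * loop 3] i, fun w => ?_⟩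
    refine equivariant_of_loops (T := fun v => deck _ (linAct (refl i) v)) (fun j v => ?_) w
    fin_cases i <;> fin_cases j <;> funext k <;> fin_cases k <;>
      simp only [reflAut_apply, reflImage, spherePi1Lift_zero, spherePi1Lift_one,
        spherePi1Lift_two, Fin.zero_eta, Fin.mk_one, Fin.reduceFinMk, Fin.castSucc_zero,
        Fin.castSucc_one, Fin.reduceCastSucc, Matrix.cons_val, map_mul,
        Equiv.Perm.mul_apply, deck_loop, deck_loop_inv, linAct_eq] <;>
      simp [puncture, refl, reflMat, Matrix.vecHead, Matrix.vecTail] <;> ring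

theorem isInducedBy_lift (w : FreeProductZ2) : IsInducedBy (glLift w) (autLift w) := by
  induction w using freeProduct_induction with
  | one => simpa using isInducedBy_one
  | gen i => simpa [glLift, autLift] using isInducedBy_refl i
  | mul x y hx hy => simpa using hx.mul hy

/-- The morphism `Γ₂^* → Out(π₁(𝕊²₄))`. -/
noncomputable def modularMorphism : GammaTwoStar →* Out SpherePi1 :=
  ((QuotientGroup.mk' _).comp autLift).comp freeEquivGammaTwoStar.symm.toMonoidHom

theorem modularMorphism_freeEquiv (w : FreeProductZ2) :
    modularMorphism (freeEquivGammaTwoStar w) = (autLift w : Out SpherePi1) := by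
  simp [modularMorphism]

theorem eq_mul_conj_of_mk_eq {Φ Φ' : MulAut SpherePi1}
    (h : (Φ : Out SpherePi1) = (Φ' : Out SpherePi1)) : ∃ u, Φ' = Φ * MulAut.conj u := by
  obtain ⟨u, hu⟩ := QuotientGroup.eq.mp h
  exact ⟨u, by rw [hu]; group⟩

/-- A class in PGL(2, ℤ) fixes N up to sign and a class in `Out` fixes Φ up to conjugation; neither
ambiguity affects `IsInducedBy`. -/
theorem isModularMorphism_modularMorphism : IsModularMorphism modularMorphism := by
  intro N hN Φ h
  obtain ⟨w, hw⟩ := freeEquivGammaTwoStar.surjective ⟨Matrix.ProjGenLinGroup.mk N, hN⟩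
  rw [← hw, modularMorphism_freeEquiv] at h
  obtain ⟨u, rfl⟩ := eq_mul_conj_of_mk_eq h
  have hmk : Matrix.ProjGenLinGroup.mk (glLift w) = Matrix.ProjGenLinGroup.mk N :=
    congrArg Subtype.val hw
  obtain ⟨e, he⟩ := Matrix.ProjGenLinGroup.mk_eq_mk_iff.mp hmk
  have hind := isInducedBy_lift w
  rcases Int.units_eq_one_or e with rfl | rfl
  · rw [map_one, mul_one] at he
    rw [← he]
    exact hind.mul_conj u
  · have : N = -glLift w := by
      rw [← he]
      ext i j
      fin_cases j <;> simp [Matrix.mul_apply]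
    rw [this]
    exact (hind.mul_conj u).neg

/-! The three involutions of the surface -/

/-- Indices are read modulo 3: the equation is invariant under cyclic relabelling, so one argument
serves the three coordinates. -/
theorem mem_surface_iff {A B C D : ℂ} {p : Fin 3 → ℂ} (i : Fin 3) : p ∈ surface A B C D ↔
    p i ^ 2 + p (i + 1) ^ 2 + p (i + 2) ^ 2 + p i * p (i + 1) * p (i + 2) =
      ![A, B, C] i * p i + ![A, B, C] (i + 1) * p (i + 1) + ![A, B, C] (i + 2) * p (i + 2) + D := by
  fin_cases i <;> simp only [surface, Set.mem_ofPred_eq] <;>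
    constructor <;> intro h <;> simp at h ⊢ <;> linear_combination h

theorem involution_apply_self {A B C D : ℂ} (i : Fin 3) (p : surface A B C D) :
    ((involution A B C D i : Equiv.Perm (surface A B C D)) p : Fin 3 → ℂ) i =
      ![A, B, C] i - p.1 i - p.1 (i + 1) * p.1 (i + 2) := by
  fin_cases i
  · rfl
  · change B - p.1 1 - p.1 0 * p.1 2 = B - p.1 1 - p.1 2 * p.1 0
    ring
  · rfl

theorem involution_apply_of_ne {A B C D : ℂ} {i j : Fin 3} (hij : j ≠ i) (p : surface A B C D) :
    ((involution A B C D i : Equiv.Perm (surface A B C D)) p : Fin 3 → ℂ) j = p.1 j := by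
  fin_cases i <;> fin_cases j <;> first | exact absurd rfl hij | rfl

theorem fin_three_cases {i j : Fin 3} (hij : j ≠ i) : j = i + 1 ∨ j = i + 2 := by
  revert i j; decide

theorem fin_three_add_one_ne (i : Fin 3) : i + 1 ≠ i := by revert i; decide

theorem fin_three_add_two_ne (i : Fin 3) : i + 2 ≠ i := by revert i; decide

theorem surface_ext {A B C D : ℂ} (i : Fin 3) {p q : surface A B C D} (h0 : p.1 i = q.1 i)
    (h1 : p.1 (i + 1) = q.1 (i + 1)) (h2 : p.1 (i + 2) = q.1 (i + 2)) : p = q := by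
  refine Subtype.ext (funext fun j => ?_)
  by_cases hj : j = i
  · rw [hj, h0]
  · rcases fin_three_cases hj with rfl | rfl
    · exact h1
    · exact h2

theorem involution_mul_self (A B C D : ℂ) (i : Fin 3) :
    involution A B C D i * involution A B C D i = 1 := by
  refine Subtype.ext (Equiv.ext fun p => ?_)
  change (involution A B C D i : Equiv.Perm (surface A B C D))
    ((involution A B C D i : Equiv.Perm (surface A B C D)) p) = p
  refine surface_ext i ?_ ?_ ?_
  · rw [involution_apply_self, involution_apply_self,
      involution_apply_of_ne (fin_three_add_one_ne i),
      involution_apply_of_ne (fin_three_add_two_ne i)]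
    ring
  · simp [involution_apply_of_ne (fin_three_add_one_ne i)]
  · simp [involution_apply_of_ne (fin_three_add_two_ne i)]

/-- The morphism from the free product to the group of polynomial automorphisms. -/
def polyLift (A B C D : ℂ) : FreeProductZ2 →* polyAut A B C D :=
  freeLift (involution A B C D) (involution_mul_self A B C D)

theorem range_polyLift (A B C D : ℂ) : (polyLift A B C D).range = involutionGroup A B C D :=
  freeLift_range _ _

/-- The points of the surface close to infinity at which the `i`-th coordinate dominates. -/
def dominantSet (A B C D : ℂ) (i : Fin 3) : Set (surface A B C D) :=
  {p | ∀ j, j ≠ i → 3 + ‖A‖ + ‖B‖ + ‖C‖ < ‖p.1 j‖ ∧ ‖p.1 j‖ < ‖p.1 i‖}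

/-! ### Ping-pong near infinity on the surface -/

theorem norm_coeff_le (A B C : ℂ) (i : Fin 3) : ‖![A, B, C] i‖ ≤ ‖A‖ + ‖B‖ + ‖C‖ := by
  have := norm_nonneg A
  have := norm_nonneg B
  have := norm_nonneg C
  fin_cases i <;> simp <;> linarith

theorem dominantSet_nonempty (A B C D : ℂ) (i : Fin 3) : (dominantSet A B C D i).Nonempty := by
  set r : ℝ := 4 + ‖A‖ + ‖B‖ + ‖C‖ with hr
  have hr4 : 4 ≤ r := by
    have := norm_nonneg A
    have := norm_nonneg B
    have := norm_nonneg C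
    linarith
  set t : ℂ := (r : ℂ) with ht
  set θ := ![A, B, C] with hθ
  have hnorm : ‖t‖ = r := by
    rw [ht, Complex.norm_real, Real.norm_of_nonneg (by linarith)]
  set b : ℂ := t ^ 2 - θ i with hb
  set c : ℂ := 2 * t ^ 2 - (θ (i + 1) + θ (i + 2)) * t - D with hc
  have hbn : 2 * r < ‖b‖ := by
    have h1 : ‖t ^ 2‖ - ‖θ i‖ ≤ ‖b‖ := norm_sub_norm_le _ _
    have h2 := norm_coeff_le A B C i
    rw [norm_pow, hnorm] at h1
    rw [← hθ] at h2
    nlinarith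
  -- The point sought has `i`-th coordinate u and both other coordinates t. The equation becomes u²
  -- + bu + c = 0; its roots have sum -b with |b| > 2r, so one of them exceeds r in norm.
  obtain ⟨w, hw⟩ := IsAlgClosed.exists_pow_nat_eq (b ^ 2 - 4 * c) (n := 2) (by norm_num)
  obtain ⟨u, hu, hun⟩ : ∃ u : ℂ, u ^ 2 + b * u + c = 0 ∧ r < ‖u‖ := by
    have h1 : ‖(-b + w) / 2 + (-b - w) / 2‖ ≤ ‖(-b + w) / 2‖ + ‖(-b - w) / 2‖ := norm_add_le _ _
    rw [show (-b + w) / 2 + (-b - w) / 2 = -b by ring, norm_neg] at h1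
    by_cases h : r < ‖(-b + w) / 2‖
    · exact ⟨_, by linear_combination hw / 4, h⟩
    · exact ⟨(-b - w) / 2, by linear_combination hw / 4, by linarith⟩
  let p : Fin 3 → ℂ := fun j => if j = i then u else t
  have hp0 : p i = u := by simp [p]
  have hp : ∀ j, j ≠ i → p j = t := fun j hj => by simp [p, hj]
  refine ⟨⟨p, ?_⟩, fun j hj => ?_⟩
  · rw [mem_surface_iff i, hp0, hp _ (fin_three_add_one_ne i), hp _ (fin_three_add_two_ne i)]
    linear_combination hu
  · change _ < ‖p j‖ ∧ ‖p j‖ < ‖p i‖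
    rw [hp0, hp j hj, hnorm]
    exact ⟨by linarith, hun⟩

/-- The product ac dominates: |ac| exceeds (3 + |t|)|a|, while t and b together contribute at most
|t| + |a|. -/
theorem norm_lt_norm_involution {a b c t : ℂ} {R : ℝ} (hR : 3 + ‖t‖ ≤ R) (hc : R < ‖c‖)
    (hca : ‖c‖ < ‖a‖) (hba : ‖b‖ < ‖a‖) : ‖a‖ < ‖t - b - a * c‖ := by
  have h1 : ‖a * c‖ - ‖t - b‖ ≤ ‖t - b - a * c‖ := by
    rw [norm_sub_rev (t - b)]
    exact norm_sub_norm_le _ _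
  have h2 : ‖t - b‖ ≤ ‖t‖ + ‖b‖ := norm_sub_le _ _
  rw [norm_mul] at h1
  have := norm_nonneg t
  nlinarith

theorem polyLift_injective (A B C D : ℂ) : Function.Injective (polyLift A B C D) := by
  refine freeLift_injective _ _ (dominantSet A B C D) (dominantSet_nonempty A B C D) ?_ ?_
  · intro i j hij p hi hj
    exact lt_asymm (hi j hij.symm).2 (hj i hij).2
  · intro i j hij p hj
    change (involution A B C D i : Equiv.Perm (surface A B C D)) p ∈ _
    obtain ⟨k, hki, hkj, hprod⟩ : ∃ k, k ≠ i ∧ k ≠ j ∧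
        p.1 (i + 1) * p.1 (i + 2) = p.1 j * p.1 k := by
      rcases fin_three_cases hij.symm with rfl | rfl
      · exact ⟨i + 2, fin_three_add_two_ne i, by simp, rfl⟩
      · exact ⟨i + 1, fin_three_add_one_ne i, by simp, mul_comm _ _⟩
    have hlt : ‖p.1 j‖ <
        ‖((involution A B C D i : Equiv.Perm (surface A B C D)) p : Fin 3 → ℂ) i‖ := by
      rw [involution_apply_self, hprod]
      exact norm_lt_norm_involution (R := 3 + ‖A‖ + ‖B‖ + ‖C‖)
        (by linarith [norm_coeff_le A B C i]) (hj k hkj).1 (hj k hkj).2 (hj i hij).2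
    intro l hl
    rw [involution_apply_of_ne hl]
    by_cases hlj : l = j
    · subst hlj
      exact ⟨(hj k hkj).1.trans (hj k hkj).2, hlt⟩
    · exact ⟨(hj l hlj).1, (hj l hlj).2.trans hlt⟩

/-- `𝒜` is the free product of the groups generated by the three involutions. -/
noncomputable def freeEquivInvolutionGroup (A B C D : ℂ) :
    FreeProductZ2 ≃* involutionGroup A B C D :=
  (MonoidHom.ofInjective (polyLift_injective A B C D)).trans
    (MulEquiv.subgroupCongr (range_polyLift A B C D))

theorem freeEquivInvolutionGroup_freeGen (A B C D : ℂ) (i : Fin 3) :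
    (freeEquivInvolutionGroup A B C D (freeGen i) : polyAut A B C D) = involution A B C D i :=
  freeLift_freeGen (involution A B C D) (involution_mul_self A B C D) i

/-! The action on characters -/

theorem tr_def (ρ : SphereRep) (g : SpherePi1) : tr ρ g = (ρ g).1.trace := rfl

theorem tr_mul_comm (ρ : SphereRep) (g h : SpherePi1) : tr ρ (g * h) = tr ρ (h * g) := by
  rw [tr_def, tr_def, map_mul, map_mul, Matrix.SpecialLinearGroup.coe_mul,
    Matrix.SpecialLinearGroup.coe_mul, Matrix.trace_mul_comm]

theorem tr_inv (ρ : SphereRep) (g : SpherePi1) : tr ρ g⁻¹ = tr ρ g := by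
  simp [tr_def, Matrix.SpecialLinearGroup.coe_inv, Matrix.adjugate_fin_two,
    Matrix.trace_fin_two, add_comm]

/-- Cayley–Hamilton in SL(2): h + h⁻¹ = tr(h) · 1. -/
theorem tr_mul_inv (ρ : SphereRep) (g h : SpherePi1) :
    tr ρ (g * h⁻¹) = tr ρ g * tr ρ h - tr ρ (g * h) := by
  simp only [tr_def, map_mul, map_inv, Matrix.SpecialLinearGroup.coe_mul,
    Matrix.SpecialLinearGroup.coe_inv, Matrix.adjugate_fin_two,
    Matrix.trace_fin_two, Matrix.mul_apply, Fin.sum_univ_two, Matrix.of_apply, Matrix.cons_val',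
    Matrix.cons_val_zero, Matrix.cons_val_one, Matrix.cons_val_fin_one]
  ring

theorem tr_conj (ρ : SphereRep) (g h : SpherePi1) : tr ρ (g * h * g⁻¹) = tr ρ h := by
  rw [tr_mul_comm, ← mul_assoc, inv_mul_cancel, one_mul]

theorem tr_of_isConj (ρ : SphereRep) {g h : SpherePi1} (hgh : IsConj g h) : tr ρ g = tr ρ h := by
  obtain ⟨c, rfl⟩ := isConj_iff.mp hgh
  exact (tr_conj ρ c g).symm

theorem tr_repAct (Φ : MulAut SpherePi1) (ρ : SphereRep) (g : SpherePi1) :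
    tr (repAct Φ ρ) g = tr ρ (Φ⁻¹ g) := rfl

theorem repAct_mul (Φ Φ' : MulAut SpherePi1) (ρ : SphereRep) :
    repAct (Φ * Φ') ρ = repAct Φ (repAct Φ' ρ) := by
  refine MonoidHom.ext fun g => ?_
  change ρ ((Φ * Φ')⁻¹ g) = ρ (Φ'⁻¹ (Φ⁻¹ g))
  rw [mul_inv_rev, MulAut.mul_apply]

theorem reflAut_inv (i : Fin 3) : (reflAut i)⁻¹ = reflAut i :=
  inv_eq_of_mul_eq_one_left (reflAut_mul_self i)

theorem charXYZ_mul_conj (Φ : MulAut SpherePi1) (u : SpherePi1) (ρ : SphereRep) :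
    charXYZ (repAct (Φ * MulAut.conj u) ρ) = charXYZ (repAct Φ ρ) := by
  have key : ∀ g, tr (repAct (Φ * MulAut.conj u) ρ) g = tr (repAct Φ ρ) g := by
    intro g
    rw [tr_repAct, tr_repAct, mul_inv_rev, MulAut.mul_apply, ← map_inv, MulAut.conj_apply, tr_conj]
  simp only [charXYZ, key]

theorem charParams_repAct_refl (i : Fin 3) (ρ : SphereRep) :
    charParams (repAct (reflAut i) ρ) = charParams ρ := by
  have key : ∀ j, tr (repAct (reflAut i) ρ) (loop j) = tr ρ (loop j) := by
    intro j
    rw [tr_repAct, reflAut_inv, tr_of_isConj ρ (reflAut_peripheral i j), tr_inv]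
  simp only [charParams, key]

theorem tr_loop_three (ρ : SphereRep) :
    tr ρ (loop 3) = tr ρ (loop 0 * loop 1 * loop 2) := by
  rw [loop_three, tr_inv]

/-- Two of the products αβ, βγ, γα keep their trace. The third becomes u v⁻¹ u⁻¹ w⁻¹, whose trace is
tr v tr w + tr u tr(vwu) - tr(vw) - tr(wu) tr(uv). Since d = tr(αβγ), for the first reflection this
is (ab + cd) - x - yz. -/
theorem charXYZ_repAct_refl {A B C D : ℂ} (i : Fin 3) (ρ : SphereRep) (p : surface A B C D)
    (hρ : charParams ρ = ![A, B, C, D]) (hp : (p : Fin 3 → ℂ) = charXYZ ρ) :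
    ((involution A B C D i : Equiv.Perm (surface A B C D)) p : Fin 3 → ℂ) =
      charXYZ (repAct (reflAut i) ρ) := by
  have hA := congrFun hρ 0
  have hB := congrFun hρ 1
  have hC := congrFun hρ 2
  simp only [charParams, Matrix.cons_val, tr_loop_three] at hA hB hC
  have cyc1 : tr ρ (loop 1 * loop 2 * loop 0) = tr ρ (loop 0 * loop 1 * loop 2) := by
    rw [tr_mul_comm, mul_assoc]
  have cyc2 : tr ρ (loop 2 * loop 0 * loop 1) = tr ρ (loop 0 * loop 1 * loop 2) := by
    rw [mul_assoc, tr_mul_comm]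
  -- `tr(u v⁻¹ u⁻¹ w⁻¹)` in terms of the traces of products of the letters
  have main : ∀ u v w : SpherePi1, tr ρ (u * v⁻¹ * u⁻¹ * w⁻¹) =
      tr ρ v * tr ρ w + tr ρ u * tr ρ (v * w * u) - tr ρ (v * w) - tr ρ (w * u) * tr ρ (u * v) := by
    intro u v w
    have e1 : tr ρ (u * v⁻¹ * u⁻¹ * w⁻¹) = tr ρ (u⁻¹ * w⁻¹ * u * v⁻¹) := by
      rw [mul_assoc, tr_mul_comm]
      simp only [mul_assoc]
    have e2 : tr ρ (u⁻¹ * w⁻¹ * u) = tr ρ w := by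
      have := tr_conj ρ u⁻¹ w⁻¹
      rw [inv_inv] at this
      rw [this, tr_inv]
    have e3 : tr ρ (u⁻¹ * w⁻¹ * u * v) = tr ρ (u * v * (w * u)⁻¹) := by
      rw [mul_assoc, tr_mul_comm, mul_inv_rev]
    have e4 : tr ρ (u * v * (w * u)) = tr ρ (v * w * u * u) := by
      rw [mul_assoc, tr_mul_comm]
      simp only [mul_assoc]
    have e5 := tr_mul_inv ρ (v * w * u) u
    rw [mul_inv_cancel_right] at e5
    rw [e1, tr_mul_inv, e2, e3, tr_mul_inv, e4]
    linear_combination e5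
  have h0 := congrFun hp 0
  have h1 := congrFun hp 1
  have h2 := congrFun hp 2
  simp only [charXYZ, Matrix.cons_val] at h0 h1 h2
  have hinv : ∀ u v : SpherePi1, tr ρ (u⁻¹ * v⁻¹) = tr ρ (u * v) := by
    intro u v
    rw [← mul_inv_rev, tr_inv, tr_mul_comm]
  have hl : ∀ u v : SpherePi1, tr ρ (u⁻¹ * (u * v⁻¹ * u⁻¹)) = tr ρ (u * v) := by
    intro u v
    rw [show u⁻¹ * (u * v⁻¹ * u⁻¹) = v⁻¹ * u⁻¹ by group, ← mul_inv_rev, tr_inv]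
  funext j
  fin_cases i <;> fin_cases j <;>
    simp only [charXYZ, tr_repAct, reflAut_inv, reflAut_apply, reflImage, map_mul,
      spherePi1Lift_zero, spherePi1Lift_one, spherePi1Lift_two, Fin.zero_eta, Fin.mk_one,
      Fin.reduceFinMk, Matrix.cons_val]
  · rw [main, involution_apply_self]
    change A - p.1 0 - p.1 1 * p.1 2 = _
    rw [h0, h1, h2, ← hA]
  · rw [involution_apply_of_ne (by decide), hinv, h1]
  · rw [involution_apply_of_ne (by decide), hl, h2]
  · rw [involution_apply_of_ne (by decide), hl, h0]
  · rw [main, involution_apply_self, cyc1]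
    change B - p.1 1 - p.1 2 * p.1 0 = _
    rw [h0, h1, h2, ← hB]
  · rw [involution_apply_of_ne (by decide), hinv, h2]
  · rw [involution_apply_of_ne (by decide), hinv, h0]
  · rw [involution_apply_of_ne (by decide), hl, h1]
  · rw [main, involution_apply_self, cyc2]
    change C - p.1 2 - p.1 0 * p.1 1 = _
    rw [h0, h1, h2, ← hC]
    ring

/-- The action of `Γ₂^*` on the surface. -/
noncomputable def modularAction (A B C D : ℂ) : GammaTwoStar →* polyAut A B C D :=
  (polyLift A B C D).comp freeEquivGammaTwoStar.symm.toMonoidHom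

theorem modularAction_injective (A B C D : ℂ) : Function.Injective (modularAction A B C D) :=
  (polyLift_injective A B C D).comp freeEquivGammaTwoStar.symm.injective

theorem range_modularAction (A B C D : ℂ) :
    (modularAction A B C D).range = involutionGroup A B C D := by
  rw [← range_polyLift, modularAction, MonoidHom.range_comp,
    MonoidHom.range_eq_top.mpr freeEquivGammaTwoStar.symm.surjective, MonoidHom.range_eq_map]

/-- The boundary parameters are carried through the induction so that the transformed representation
still gives a point of the same surface. -/
theorem polyLift_charXYZ {A B C D : ℂ} (w : FreeProductZ2) :
    ∀ (ρ : SphereRep) (p : surface A B C D), charParams ρ = ![A, B, C, D] →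
      (p : Fin 3 → ℂ) = charXYZ ρ → charParams (repAct (autLift w) ρ) = charParams ρ ∧
      ((polyLift A B C D w : Equiv.Perm (surface A B C D)) p : Fin 3 → ℂ) =
        charXYZ (repAct (autLift w) ρ) := by
  induction w using freeProduct_induction with
  | one =>
    intro ρ p hρ hp
    rw [map_one, map_one]
    exact ⟨rfl, hp⟩
  | gen i =>
    intro ρ p hρ hp
    rw [autLift, polyLift, freeLift_freeGen, freeLift_freeGen]
    exact ⟨charParams_repAct_refl i ρ, charXYZ_repAct_refl i ρ p hρ hp⟩
  | mul x y hx hy =>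
    intro ρ p hρ hp
    obtain ⟨h1, h2⟩ := hy ρ p hρ hp
    obtain ⟨h3, h4⟩ := hx _ _ (h1.trans hρ) h2
    rw [map_mul, map_mul, repAct_mul]
    exact ⟨h3.trans h1, h4⟩

theorem isInducedAction_modularAction (A B C D : ℂ) :
    IsInducedAction A B C D modularMorphism (modularAction A B C D) := by
  intro M Φ h ρ p hρ hp
  obtain ⟨w, rfl⟩ := freeEquivGammaTwoStar.surjective M
  rw [modularMorphism_freeEquiv] at h
  obtain ⟨u, rfl⟩ := eq_mul_conj_of_mk_eq h
  rw [charXYZ_mul_conj]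
  simpa [modularAction] using (polyLift_charXYZ w ρ p hρ hp).2

end CubicSurface

namespace CubicSurface

open Polynomial

/-! The degree in a quadratic extension -/

/-- `X² - 4` is not a square in `ℂ(X)`. -/
theorem sq_sub_X_mul_add_sq_ne_zero {p q : ℂ[X]} (h : p ≠ 0 ∨ q ≠ 0) :
    p * p - X * p * q + q * q ≠ 0 := by
  intro h0
  have hq : q ≠ 0 := by
    rintro rfl
    simp at h0 h
    exact h h0
  -- Completing the square gives (2p - Xq)² = (X² - 4)q², and the two sides have root multiplicities
  -- of different parity at 2.
  have hsq : (2 * p - X * q) * (2 * p - X * q) = (X - C 2) * ((X + C 2) * (q * q)) := by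
    simp only [map_ofNat]
    linear_combination 4 * h0
  have hr : (2 * p - X * q) ≠ 0 := by
    intro hr
    rw [hr, mul_zero] at hsq
    refine mul_ne_zero (X_sub_C_ne_zero 2) (mul_ne_zero (X_add_C_ne_zero 2)
      (mul_ne_zero hq hq)) hsq.symm
  have h2 : rootMultiplicity 2 (X + C 2 : ℂ[X]) = 0 := by
    apply rootMultiplicity_eq_zero
    norm_num [IsRoot]
  have := congrArg (rootMultiplicity 2) hsq
  rw [rootMultiplicity_mul (mul_ne_zero hr hr), rootMultiplicity_mul
    (mul_ne_zero (X_sub_C_ne_zero 2) (mul_ne_zero (X_add_C_ne_zero 2) (mul_ne_zero hq hq))),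
    rootMultiplicity_mul (mul_ne_zero (X_add_C_ne_zero 2) (mul_ne_zero hq hq)),
    rootMultiplicity_mul (mul_ne_zero hq hq), rootMultiplicity_X_sub_C_self, h2] at this
  omega

/-- The polynomials in three variables modulo the equation of the surface, as a free module of
rank `2` over the polynomials in the first two variables. -/
abbrev CubicRing (a b c D : ℂ) : Type :=
  QuadraticAlgebra ℂ[X][X]
    (C (C D + C a * X - X ^ 2) + C (C b) * X - X ^ 2) (C (C c) - C X * X)

namespace CubicRing

variable {a b c D : ℂ}

open Classical in
/-- The degree in the second and third variables. -/
noncomputable def deg (q : CubicRing a b c D) : ℕ :=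
  if q.im = 0 then q.re.natDegree else max q.re.natDegree (q.im.natDegree + 1)

theorem norm_eq (q : CubicRing a b c D) : q.norm = q.re * q.re + (C (C c) - C X * X) * q.re * q.im
    + (X ^ 2 - C (C b) * X - C (C D + C a * X - X ^ 2)) * q.im * q.im := by
  rw [QuadraticAlgebra.norm_def]
  ring

/-- If p and q are the coefficients of `re` in degree k + 1 and of `im` in degree k, the norm has
coefficient p² - Xpq + q² in degree 2(k + 1), which does not vanish. Multiplicativity of the norm
then makes `deg` additive on products. -/
theorem norm_ne_zero_and_natDegree {q : CubicRing a b c D} (hq : q ≠ 0) :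
    q.norm ≠ 0 ∧ q.norm.natDegree = 2 * q.deg := by
  by_cases him : q.im = 0
  · have hre : q.re ≠ 0 := fun hre => hq (QuadraticAlgebra.ext hre him)
    rw [norm_eq, him, deg, if_pos him]
    simp [hre, natDegree_mul hre hre, two_mul]
  -- The third variable has weight one, so with k + 1 the total degree, at least one of the
  -- coefficients of `re` at k + 1 and of `im` at k is a leading coefficient.
  · obtain ⟨k, hk⟩ : ∃ k, max q.re.natDegree (q.im.natDegree + 1) = k + 1 :=
      ⟨max q.re.natDegree (q.im.natDegree + 1) - 1, by omega⟩
    have hre : q.re.natDegree ≤ k + 1 := by omega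
    have himk : q.im.natDegree ≤ k := by omega
    have hl1 : (C (C c) - C X * X : ℂ[X][X]).natDegree ≤ 1 := by compute_degree
    have hl2 : (X ^ 2 - C (C b) * X - C (C D + C a * X - X ^ 2) : ℂ[X][X]).natDegree ≤ 2 := by
      compute_degree
    have hm1 : ((C (C c) - C X * X) * q.re : ℂ[X][X]).natDegree ≤ 1 + (k + 1) :=
      natDegree_mul_le_of_le hl1 hre
    have hm2 : ((X ^ 2 - C (C b) * X - C (C D + C a * X - X ^ 2)) * q.im : ℂ[X][X]).natDegree ≤
      2 + k := natDegree_mul_le_of_le hl2 himk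
    have hdeg : q.norm.natDegree ≤ 2 * (k + 1) := by
      rw [norm_eq]
      refine natDegree_add_le_of_degree_le (natDegree_add_le_of_degree_le ?_ ?_) ?_
      · exact (natDegree_mul_le_of_le hre hre).trans (by omega)
      · exact (natDegree_mul_le_of_le hm1 himk).trans (by omega)
      · exact (natDegree_mul_le_of_le hm2 himk).trans (by omega)
    have hcoeff : q.norm.coeff (2 * (k + 1)) = q.re.coeff (k + 1) * q.re.coeff (k + 1) -
        X * q.re.coeff (k + 1) * q.im.coeff k + q.im.coeff k * q.im.coeff k := by
      rw [norm_eq, coeff_add, coeff_add]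
      have e1 : (q.re * q.re).coeff (2 * (k + 1)) = q.re.coeff (k + 1) * q.re.coeff (k + 1) := by
        rw [two_mul, coeff_mul_add_eq_of_natDegree_le hre hre]
      have e2 : ((C (C c) - C X * X) * q.re * q.im).coeff (2 * (k + 1)) =
          -X * q.re.coeff (k + 1) * q.im.coeff k := by
        rw [show 2 * (k + 1) = (1 + (k + 1)) + k by omega,
          coeff_mul_add_eq_of_natDegree_le hm1 himk,
          coeff_mul_add_eq_of_natDegree_le hl1 hre]
        simp [coeff_C]
      have e3 : ((X ^ 2 - C (C b) * X - C (C D + C a * X - X ^ 2)) * q.im * q.im).coeff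
          (2 * (k + 1)) = q.im.coeff k * q.im.coeff k := by
        rw [show 2 * (k + 1) = (2 + k) + k by omega, coeff_mul_add_eq_of_natDegree_le hm2 himk,
          coeff_mul_add_eq_of_natDegree_le hl2 himk]
        have : ((C X : ℂ[X][X]) ^ 2).coeff 2 = 0 := by rw [← C_pow, coeff_C_of_ne_zero two_ne_zero]
        simp [this]
      rw [e1, e2, e3]
      ring
    have hne : q.norm.coeff (2 * (k + 1)) ≠ 0 := by
      rw [hcoeff]
      apply sq_sub_X_mul_add_sq_ne_zero
      rcases le_total q.re.natDegree (q.im.natDegree + 1) with h | h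
      · right
        rw [show k = q.im.natDegree by omega]
        exact leadingCoeff_ne_zero.mpr him
      · left
        rw [show k + 1 = q.re.natDegree by omega]
        refine leadingCoeff_ne_zero.mpr fun h0 => ?_
        rw [h0, natDegree_zero] at h
        omega
    refine ⟨fun h0 => hne (by rw [h0, coeff_zero]), ?_⟩
    rw [deg, if_neg him, hk]
    exact natDegree_eq_of_le_of_coeff_ne_zero hdeg hne

theorem norm_ne_zero {q : CubicRing a b c D} (hq : q ≠ 0) : q.norm ≠ 0 :=
  (norm_ne_zero_and_natDegree hq).1

instance : NoZeroDivisors (CubicRing a b c D) where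
  eq_zero_or_eq_zero_of_mul_eq_zero := by
    intro q r h
    by_contra! hne
    apply mul_ne_zero (norm_ne_zero hne.1) (norm_ne_zero hne.2)
    rw [← map_mul, h, QuadraticAlgebra.norm_zero]

theorem deg_mul {q r : CubicRing a b c D} (hq : q ≠ 0) (hr : r ≠ 0) :
    (q * r).deg = q.deg + r.deg := by
  have h1 := (norm_ne_zero_and_natDegree hq).2
  have h2 := (norm_ne_zero_and_natDegree hr).2
  have h3 := (norm_ne_zero_and_natDegree (mul_ne_zero hq hr)).2
  rw [map_mul, natDegree_mul (norm_ne_zero hq) (norm_ne_zero hr)] at h3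
  omega

theorem natDegree_re_le_deg (q : CubicRing a b c D) : q.re.natDegree ≤ q.deg := by
  unfold deg
  split_ifs <;> simp

theorem natDegree_im_lt_deg {q : CubicRing a b c D} (hq : q.im ≠ 0) :
    q.im.natDegree + 1 ≤ q.deg := by
  simp [deg, hq]

theorem deg_add_le (q r : CubicRing a b c D) : (q + r).deg ≤ max q.deg r.deg := by
  have hre : (q + r).re.natDegree ≤ max q.deg r.deg :=
    (natDegree_add_le _ _).trans (max_le_max (natDegree_re_le_deg q) (natDegree_re_le_deg r))
  by_cases h : (q + r).im = 0
  · rwa [deg, if_pos h]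
  · rw [deg, if_neg h]
    refine max_le hre ?_
    have hadd : (q + r).im.natDegree ≤ max q.im.natDegree r.im.natDegree := natDegree_add_le _ _
    by_cases hq : q.im = 0
    · have hr : r.im ≠ 0 := by
        intro hr
        apply h
        simp [hq, hr]
      have := natDegree_im_lt_deg hr
      rw [hq, natDegree_zero] at hadd
      omega
    · have h1 := natDegree_im_lt_deg hq
      by_cases hr : r.im = 0
      · rw [hr, natDegree_zero] at hadd
        omega
      · have h2 := natDegree_im_lt_deg hr
        omega

theorem exists_of_deg_eq_zero {q : CubicRing a b c D} (hq : q.deg = 0) :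
    ∃ p : ℂ[X], q = ⟨C p, 0⟩ := by
  have him : q.im = 0 := by
    by_contra him
    have := natDegree_im_lt_deg him
    omega
  obtain ⟨p, hp⟩ := natDegree_eq_zero.mp (Nat.le_zero.mp (hq ▸ natDegree_re_le_deg q))
  exact ⟨p, QuadraticAlgebra.ext hp.symm him⟩

end CubicRing

/-! Polynomial functions on the surface -/

/-- The restriction of a coordinate to the surface. -/
def coord {A B C D : ℂ} (i : Fin 3) : surface A B C D → ℂ := fun p => p.1 i

/-- The algebra of polynomial functions on the surface. -/
noncomputable def polyFun (A B C D : ℂ) : Subalgebra ℂ (surface A B C D → ℂ) :=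
  (MvPolynomial.aeval (R := ℂ) (coord (A := A) (B := B) (C := C) (D := D))).range

variable {A B C D : ℂ}

theorem mem_polyFun_iff {g : surface A B C D → ℂ} : g ∈ polyFun A B C D ↔
    ∃ P : MvPolynomial (Fin 3) ℂ, ∀ p, g p = MvPolynomial.eval p.1 P := by
  have key : ∀ (P : MvPolynomial (Fin 3) ℂ) (p : surface A B C D),
      MvPolynomial.aeval (R := ℂ) coord P p = MvPolynomial.eval p.1 P := by
    intro P p
    induction P using MvPolynomial.induction_on with
    | C a => simp
    | add P Q hP hQ => simp [hP, hQ]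
    | mul_X P i hP => simp [hP, coord]
  constructor
  · rintro ⟨P, rfl⟩
    exact ⟨P, key P⟩
  · rintro ⟨P, hP⟩
    exact ⟨P, funext fun p => (key P p).trans (hP p).symm⟩

/-- A coordinate, as a polynomial function. -/
noncomputable def coordFun (i : Fin 3) : polyFun A B C D :=
  ⟨coord i, MvPolynomial.X i, by simp⟩

theorem coordFun_relation (i : Fin 3) :
    (coordFun i ^ 2 + coordFun (i + 1) ^ 2 + coordFun (i + 2) ^ 2 +
      coordFun i * coordFun (i + 1) * coordFun (i + 2) : polyFun A B C D) =
    algebraMap ℂ _ (![A, B, C] i) * coordFun i +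
      algebraMap ℂ _ (![A, B, C] (i + 1)) * coordFun (i + 1) +
      algebraMap ℂ _ (![A, B, C] (i + 2)) * coordFun (i + 2) + algebraMap ℂ _ D :=
  Subtype.ext (funext fun p => (mem_surface_iff i).mp p.2)

/-- Evaluation on the surface of an element of the quadratic extension, where the coordinate of
index `i` is the base variable. -/
noncomputable def evalSurface (A B C D : ℂ) (i : Fin 3) :
    CubicRing (![A, B, C] i) (![A, B, C] (i + 1)) (![A, B, C] (i + 2)) D →ₐ[ℂ]
      (surface A B C D → ℂ) where
  toFun q p := q.re.evalEval (p.1 i) (p.1 (i + 1)) +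
    q.im.evalEval (p.1 i) (p.1 (i + 1)) * p.1 (i + 2)
  map_one' := by
    funext p
    simp [QuadraticAlgebra.re_one, QuadraticAlgebra.im_one]
  map_zero' := by funext p; simp
  map_add' q r := by
    funext p
    simp
    ring
  map_mul' q r := by
    funext p
    have h := (mem_surface_iff i).mp p.2
    simp [evalEval]
    linear_combination (eval (p.1 i) (eval (Polynomial.C (p.1 (i + 1))) q.im) *
      eval (p.1 i) (eval (Polynomial.C (p.1 (i + 1))) r.im)) * (-h)
  commutes' r := by
    funext p
    change evalEval _ _ (algebraMap ℂ ℂ[X][X] r) + evalEval _ _ 0 * _ = r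
    simp

theorem evalSurface_apply (i : Fin 3)
    (q : CubicRing (![A, B, C] i) (![A, B, C] (i + 1)) (![A, B, C] (i + 2)) D)
    (p : surface A B C D) : evalSurface A B C D i q p =
      q.re.evalEval (p.1 i) (p.1 (i + 1)) + q.im.evalEval (p.1 i) (p.1 (i + 1)) * p.1 (i + 2) :=
  rfl

theorem exists_point (i : Fin 3) (x y : ℂ) :
    ∃ p : surface A B C D, p.1 i = x ∧ p.1 (i + 1) = y := by
  set θ := ![A, B, C] with hθ
  obtain ⟨w, hw⟩ := IsAlgClosed.exists_pow_nat_eq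
    ((x * y - θ (i + 2)) ^ 2 - 4 * (x ^ 2 + y ^ 2 - θ i * x - θ (i + 1) * y - D)) (n := 2)
    (by norm_num)
  let p : Fin 3 → ℂ := fun j => if j = i then x else if j = i + 1 then y else
    (-(x * y - θ (i + 2)) + w) / 2
  have h0 : p i = x := by simp [p]
  have h1 : p (i + 1) = y := by simp [p]
  have h2 : p (i + 2) = (-(x * y - θ (i + 2)) + w) / 2 := by simp [p]
  refine ⟨⟨p, ?_⟩, h0, h1⟩
  rw [mem_surface_iff i, h0, h1, h2, ← hθ]
  linear_combination hw / 4

theorem eq_zero_of_evalEval_eq_zero {P : ℂ[X][X]} (h : ∀ x y, P.evalEval x y = 0) : P = 0 := by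
  have h1 : ∀ y, eval (Polynomial.C y) P = 0 := by
    intro y
    refine Polynomial.funext fun x => ?_
    rw [eval_zero]
    exact h x y
  refine eq_zero_of_infinite_isRoot P (Set.Infinite.mono ?_
    (Set.infinite_range_of_injective (Polynomial.C_injective (R := ℂ))))
  rintro _ ⟨y, rfl⟩
  exact h1 y

/-- Every (x, y) lifts to the surface, so an element vanishing there has a norm vanishing at all (x,
y), hence zero norm. Polynomial functions thus have unique normal forms in `CubicRing`. -/
theorem evalSurface_injective (i : Fin 3) : Function.Injective (evalSurface A B C D i) := by
  rw [injective_iff_map_eq_zero]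
  intro q hq
  by_contra hne
  refine CubicRing.norm_ne_zero hne (eq_zero_of_evalEval_eq_zero fun x y => ?_)
  obtain ⟨p, rfl, rfl⟩ := exists_point (A := A) (B := B) (C := C) (D := D) i x y
  have hz : evalSurface A B C D i (algebraMap _ _ q.norm) p = 0 := by
    rw [QuadraticAlgebra.algebraMap_norm_eq_mul_star, map_mul, hq, zero_mul, Pi.zero_apply]
  rw [evalSurface_apply] at hz
  simpa using hz

theorem range_evalSurface (i : Fin 3) : (evalSurface A B C D i).range = polyFun A B C D := by
  apply le_antisymm
  · rintro _ ⟨q, rfl⟩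
    have hbase : ∀ p : ℂ[X], (fun s : surface A B C D => p.eval (s.1 i)) ∈ polyFun A B C D := by
      intro p
      convert (aeval (coordFun i : polyFun A B C D) p).2 using 1
      funext s
      induction p using Polynomial.induction_on' with
      | add p q hp hq => simp [hp, hq]
      | monomial n a => simp [← C_mul_X_pow_eq_monomial, coordFun, coord]
    have hpoly : ∀ P : ℂ[X][X],
        (fun s : surface A B C D => P.evalEval (s.1 i) (s.1 (i + 1))) ∈ polyFun A B C D := by
      intro P
      induction P using Polynomial.induction_on' with
      | add p q hp hq =>
        convert add_mem hp hq using 1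
        funext s
        simp
      | monomial n a =>
        have := mul_mem (hbase a) (pow_mem (coordFun (i + 1) : polyFun A B C D).2 n)
        convert this using 1
        funext s
        simp [← C_mul_X_pow_eq_monomial, coordFun, coord, evalEval]
    exact add_mem (hpoly q.re) (mul_mem (hpoly q.im) (coordFun (i + 2) : polyFun A B C D).2)
  · rintro _ ⟨P, rfl⟩
    have hcoord : ∀ j, (coord j : surface A B C D → ℂ) ∈ (evalSurface A B C D i).range := by
      have h0 : (coord i : surface A B C D → ℂ) ∈ (evalSurface A B C D i).range :=
        ⟨⟨Polynomial.C X, 0⟩, by funext p; simp [evalSurface, coord, evalEval_C]⟩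
      have h1 : (coord (i + 1) : surface A B C D → ℂ) ∈ (evalSurface A B C D i).range :=
        ⟨⟨X, 0⟩, by funext p; simp [evalSurface, coord]⟩
      have h2 : (coord (i + 2) : surface A B C D → ℂ) ∈ (evalSurface A B C D i).range :=
        ⟨⟨0, 1⟩, by funext p; simp [evalSurface, coord]⟩
      intro j
      by_cases hj : j = i
      · rwa [hj]
      · rcases fin_three_cases hj with rfl | rfl
        · exact h1
        · exact h2
    induction P using MvPolynomial.induction_on with
    | C a => exact ⟨algebraMap _ _ a, by simp⟩
    | add P Q hP hQ => rw [map_add]; exact add_mem hP hQ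
    | mul_X P j hP =>
      rw [map_mul]
      refine mul_mem hP ?_
      change MvPolynomial.aeval coord (MvPolynomial.X j) ∈ _
      rw [MvPolynomial.aeval_X]
      exact hcoord j

/-- The polynomial functions on the surface form a quadratic extension. -/
noncomputable def cubicRingEquiv (i : Fin 3) :
    CubicRing (![A, B, C] i) (![A, B, C] (i + 1)) (![A, B, C] (i + 2)) D ≃ₐ[ℂ] polyFun A B C D :=
  (AlgEquiv.ofInjective _ (evalSurface_injective i)).trans
    (Subalgebra.equivOfEq _ _ (range_evalSurface i))

theorem coe_cubicRingEquiv (i : Fin 3)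
    (q : CubicRing (![A, B, C] i) (![A, B, C] (i + 1)) (![A, B, C] (i + 2)) D) :
    (cubicRingEquiv i q : surface A B C D → ℂ) = evalSurface A B C D i q := rfl

instance : NoZeroDivisors (polyFun A B C D) :=
  (cubicRingEquiv (A := A) (B := B) (C := C) (D := D) 0).symm.toMulEquiv.noZeroDivisors

/-- The order of the pole of a polynomial function along the line at infinity on which the
coordinate of index `i` is not constant. -/
noncomputable def degAt (i : Fin 3) (g : polyFun A B C D) : ℕ :=
  ((cubicRingEquiv i).symm g).deg

theorem degAt_mul (i : Fin 3) {g h : polyFun A B C D} (hg : g ≠ 0) (hh : h ≠ 0) :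
    degAt i (g * h) = degAt i g + degAt i h := by
  rw [degAt, map_mul, CubicRing.deg_mul (by simpa using hg) (by simpa using hh)]
  rfl

theorem degAt_add_le (i : Fin 3) (g h : polyFun A B C D) :
    degAt i (g + h) ≤ max (degAt i g) (degAt i h) := by
  rw [degAt, map_add]
  exact CubicRing.deg_add_le _ _

theorem cubicRingEquiv_C (i : Fin 3) (p : ℂ[X]) :
    cubicRingEquiv i ⟨Polynomial.C p, 0⟩ = aeval (coordFun i : polyFun A B C D) p := by
  refine Subtype.ext (funext fun s => ?_)
  rw [coe_cubicRingEquiv, evalSurface_apply, evalEval_C, evalEval_zero, zero_mul, add_zero]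
  induction p using Polynomial.induction_on' with
  | add p q hp hq => simp [hp, hq]
  | monomial n a => simp [← C_mul_X_pow_eq_monomial, coordFun, coord]

theorem degAt_eq_zero_iff {i : Fin 3} {g : polyFun A B C D} :
    degAt i g = 0 ↔ ∃ p : ℂ[X], g = aeval (coordFun i) p := by
  constructor
  · intro h
    obtain ⟨p, hp⟩ := CubicRing.exists_of_deg_eq_zero h
    exact ⟨p, by rw [← cubicRingEquiv_C, ← hp, AlgEquiv.apply_symm_apply]⟩
  · rintro ⟨p, rfl⟩
    rw [← cubicRingEquiv_C, degAt, AlgEquiv.symm_apply_apply]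
    simp [CubicRing.deg]

theorem degAt_coordFun_of_ne {i j : Fin 3} (hij : j ≠ i) :
    degAt i (coordFun j : polyFun A B C D) = 1 := by
  rcases fin_three_cases hij with rfl | rfl
  · have : (coordFun (i + 1) : polyFun A B C D) = cubicRingEquiv i ⟨X, 0⟩ := by
      refine Subtype.ext (funext fun s => ?_)
      simp [coe_cubicRingEquiv, evalSurface, coordFun, coord]
    rw [this, degAt, AlgEquiv.symm_apply_apply]
    simp [CubicRing.deg]
  · have : (coordFun (i + 2) : polyFun A B C D) = cubicRingEquiv i ⟨0, 1⟩ := by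
      refine Subtype.ext (funext fun s => ?_)
      simp [coe_cubicRingEquiv, evalSurface, coordFun, coord]
    rw [this, degAt, AlgEquiv.symm_apply_apply]
    simp [CubicRing.deg]

/-! Degrees of polynomial functions -/

theorem aeval_coordFun_apply (i : Fin 3) (p : ℂ[X]) (s : surface A B C D) :
    (aeval (coordFun i : polyFun A B C D) p).1 s = p.eval (s.1 i) := by
  rw [← cubicRingEquiv_C, coe_cubicRingEquiv, evalSurface_apply, evalEval_C, evalEval_zero,
    zero_mul, add_zero]

theorem aeval_coordFun_injective (i : Fin 3) :
    Function.Injective (aeval (R := ℂ) (coordFun i : polyFun A B C D)) := by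
  intro p q h
  refine Polynomial.funext fun c => ?_
  obtain ⟨s, hs, -⟩ := exists_point (A := A) (B := B) (C := C) (D := D) i c 0
  rw [← hs, ← aeval_coordFun_apply, ← aeval_coordFun_apply, h]

theorem coordFun_ne_zero (i : Fin 3) : (coordFun i : polyFun A B C D) ≠ 0 := by
  intro h
  have := aeval_coordFun_injective (A := A) (B := B) (C := C) (D := D) i (a₁ := X) (a₂ := 0)
    (by simpa using h)
  exact X_ne_zero this

theorem degAt_algebraMap (i : Fin 3) (c : ℂ) :
    degAt i (algebraMap ℂ (polyFun A B C D) c) = 0 :=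
  degAt_eq_zero_iff.mpr ⟨Polynomial.C c, by simp⟩

theorem degAt_coordFun_self (i : Fin 3) : degAt i (coordFun i : polyFun A B C D) = 0 :=
  degAt_eq_zero_iff.mpr ⟨X, by simp⟩

theorem degAt_zero (i : Fin 3) : degAt i (0 : polyFun A B C D) = 0 := by
  simpa using degAt_algebraMap (A := A) (B := B) (C := C) (D := D) i 0

theorem degAt_mul_le (i : Fin 3) (g h : polyFun A B C D) :
    degAt i (g * h) ≤ degAt i g + degAt i h := by
  by_cases hg : g = 0
  · simp [hg, degAt_zero]
  by_cases hh : h = 0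
  · simp [hh, degAt_zero]
  exact (degAt_mul i hg hh).le

theorem degAt_algebraMap_mul_le (i : Fin 3) (c : ℂ) (g : polyFun A B C D) :
    degAt i (algebraMap ℂ _ c * g) ≤ degAt i g := by
  simpa [degAt_algebraMap] using degAt_mul_le i (algebraMap ℂ _ c) g

theorem degAt_neg_le (i : Fin 3) (g : polyFun A B C D) : degAt i (-g) ≤ degAt i g := by
  have h := degAt_algebraMap_mul_le i (-1) g
  rw [map_neg, map_one] at h
  exact (neg_one_mul g) ▸ h

theorem degAt_add_le_of_le {i : Fin 3} {g h : polyFun A B C D} {n : ℕ} (hg : degAt i g ≤ n)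
    (hh : degAt i h ≤ n) : degAt i (g + h) ≤ n :=
  (degAt_add_le i g h).trans (max_le hg hh)

theorem degAt_sub_le_of_le {i : Fin 3} {g h : polyFun A B C D} {n : ℕ} (hg : degAt i g ≤ n)
    (hh : degAt i h ≤ n) : degAt i (g - h) ≤ n := by
  rw [sub_eq_add_neg]
  exact degAt_add_le_of_le hg ((degAt_neg_le i h).trans hh)

theorem degAt_mul_le_of_le {i : Fin 3} {g h : polyFun A B C D} {m n : ℕ} (hg : degAt i g ≤ m)
    (hh : degAt i h ≤ n) : degAt i (g * h) ≤ m + n :=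
  (degAt_mul_le i g h).trans (add_le_add hg hh)

/-- A component made affine in one coordinate has order one along the other two lines; this protects
it in later reductions. -/
theorem degAt_linear {i j : Fin 3} (hij : j ≠ i) {κ μ : ℂ} (hκ : κ ≠ 0) :
    degAt i (algebraMap ℂ (polyFun A B C D) κ * coordFun j + algebraMap ℂ _ μ) = 1 := by
  have hκ' : algebraMap ℂ (polyFun A B C D) κ ≠ 0 := by
    intro h
    apply hκ
    rw [← Polynomial.C_eq_zero]
    apply aeval_coordFun_injective (A := A) (B := B) (C := C) (D := D) i
    rw [aeval_C, h, map_zero]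
  have h1 : degAt i (algebraMap ℂ (polyFun A B C D) κ * coordFun j) = 1 := by
    rw [degAt_mul i hκ' (coordFun_ne_zero j), degAt_algebraMap, degAt_coordFun_of_ne hij]
  apply le_antisymm
  · exact degAt_add_le_of_le h1.le (by simp [degAt_algebraMap])
  · by_contra! hlt
    have : degAt i (algebraMap ℂ (polyFun A B C D) κ * coordFun j) ≤ 0 := by
      rw [← add_sub_cancel_right (algebraMap ℂ (polyFun A B C D) κ * coordFun j)
        (algebraMap ℂ _ μ)]
      exact degAt_sub_le_of_le (by omega) (by simp [degAt_algebraMap])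
    omega

/-! Pull-back of polynomial functions by automorphisms -/

theorem exists_aeval_coordFun (g : polyFun A B C D) :
    ∃ P : MvPolynomial (Fin 3) ℂ, g = MvPolynomial.aeval coordFun P := by
  obtain ⟨g, P, rfl⟩ := g
  refine ⟨P, Subtype.ext ?_⟩
  change MvPolynomial.aeval coord P =
    (polyFun A B C D).val (MvPolynomial.aeval coordFun P)
  rw [← AlgHom.comp_apply, MvPolynomial.comp_aeval]
  rfl

theorem comp_mem_polyFun (f : polyAut A B C D) (g : polyFun A B C D) :
    g.1 ∘ (f : Equiv.Perm (surface A B C D)) ∈ polyFun A B C D := by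
  obtain ⟨F, hF⟩ := f.2.1
  obtain ⟨P, hP⟩ := mem_polyFun_iff.mp g.2
  refine mem_polyFun_iff.mpr ⟨MvPolynomial.bind₁ F P, fun p => ?_⟩
  have h : (((f : Equiv.Perm (surface A B C D)) p : surface A B C D) : Fin 3 → ℂ) =
      fun j => MvPolynomial.aeval (p : Fin 3 → ℂ) (F j) := by
    funext j
    rw [hF, MvPolynomial.aeval_eq_eval]
  rw [Function.comp_apply, hP, h, ← MvPolynomial.aeval_eq_eval, ← MvPolynomial.aeval_eq_eval,
    MvPolynomial.aeval_bind₁]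

/-- Composition of polynomial functions with an automorphism. -/
noncomputable def pullback (f : polyAut A B C D) : polyFun A B C D →ₐ[ℂ] polyFun A B C D where
  toFun g := ⟨g.1 ∘ (f : Equiv.Perm (surface A B C D)), comp_mem_polyFun f g⟩
  map_one' := rfl
  map_zero' := rfl
  map_mul' _ _ := rfl
  map_add' _ _ := rfl
  commutes' _ := rfl

theorem pullback_mul (f g : polyAut A B C D) (h : polyFun A B C D) :
    pullback (f * g) h = pullback g (pullback f h) := rfl

theorem pullback_one (h : polyFun A B C D) : pullback 1 h = h := rfl

theorem pullback_inv_pullback (f : polyAut A B C D) (h : polyFun A B C D) :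
    pullback f⁻¹ (pullback f h) = h := by
  rw [← pullback_mul, mul_inv_cancel, pullback_one]

theorem pullback_pullback_inv (f : polyAut A B C D) (h : polyFun A B C D) :
    pullback f (pullback f⁻¹ h) = h := by
  rw [← pullback_mul, inv_mul_cancel, pullback_one]

/-- The components of an automorphism. -/
noncomputable def component (f : polyAut A B C D) (j : Fin 3) : polyFun A B C D :=
  pullback f (coordFun j)

theorem component_apply (f : polyAut A B C D) (j : Fin 3) (p : surface A B C D) :
    (component f j).1 p = ((f : Equiv.Perm (surface A B C D)) p).1 j := rfl

theorem component_ne_zero (f : polyAut A B C D) (j : Fin 3) : component f j ≠ 0 := by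
  intro h
  apply coordFun_ne_zero (A := A) (B := B) (C := C) (D := D) j
  rw [← pullback_inv_pullback f (coordFun j)]
  exact (congrArg _ h).trans (map_zero _)

/-! ### Orders of the components and their reduction by the involutions -/

theorem component_involution_mul_self (f : polyAut A B C D) (i : Fin 3) :
    component (involution A B C D i * f) i = algebraMap ℂ _ (![A, B, C] i) - component f i -
      component f (i + 1) * component f (i + 2) :=
  Subtype.ext (funext fun _ => involution_apply_self i _)

theorem component_involution_mul_of_ne (f : polyAut A B C D) {i j : Fin 3} (hij : j ≠ i) :
    component (involution A B C D i * f) j = component f j :=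
  Subtype.ext (funext fun _ => involution_apply_of_ne hij _)

theorem component_relation (f : polyAut A B C D) (i : Fin 3) :
    component f i ^ 2 + component f (i + 1) ^ 2 + component f (i + 2) ^ 2 +
      component f i * component f (i + 1) * component f (i + 2) =
    algebraMap ℂ _ (![A, B, C] i) * component f i +
      algebraMap ℂ _ (![A, B, C] (i + 1)) * component f (i + 1) +
      algebraMap ℂ _ (![A, B, C] (i + 2)) * component f (i + 2) + algebraMap ℂ _ D :=
  congrArg (pullback f) (coordFun_relation i)

/-- Otherwise all components are polynomials in the coordinate of index `k`. As the pull-back is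
surjective, so is every polynomial function, including the next coordinate, which has order one. -/
theorem exists_degAt_component_ne_zero (k : Fin 3) (f : polyAut A B C D) :
    ∃ j, degAt k (component f j) ≠ 0 := by
  by_contra! h
  have hmem : ∀ j, component f j ∈ (aeval (R := ℂ) (coordFun k : polyFun A B C D)).range := by
    intro j
    obtain ⟨p, hp⟩ := degAt_eq_zero_iff.mp (h j)
    exact ⟨p, hp.symm⟩
  have hall : ∀ g, g ∈ (aeval (R := ℂ) (coordFun k : polyFun A B C D)).range := by
    intro g
    obtain ⟨P, hP⟩ := exists_aeval_coordFun (pullback f⁻¹ g)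
    rw [← pullback_pullback_inv f g, hP]
    clear hP
    induction P using MvPolynomial.induction_on with
    | C a => exact ⟨algebraMap _ _ a, by simp⟩
    | add P Q hP hQ => rw [map_add, map_add]; exact add_mem hP hQ
    | mul_X P j hP =>
      rw [map_mul, map_mul, MvPolynomial.aeval_X]
      exact mul_mem hP (hmem j)
  obtain ⟨p, hp⟩ := hall (coordFun (k + 1))
  have h0 := degAt_eq_zero_iff.mpr ⟨p, hp.symm⟩
  rw [degAt_coordFun_of_ne (fin_three_add_one_ne k)] at h0
  exact one_ne_zero h0

/-- The largest of the degrees of the components is the sum of the two others. -/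
theorem degAt_component_eq_add (k : Fin 3) (f : polyAut A B C D) {i : Fin 3}
    (hmax : ∀ j, degAt k (component f j) ≤ degAt k (component f i)) :
    degAt k (component f i) =
      degAt k (component f (i + 1)) + degAt k (component f (i + 2)) := by
  have hpos : 0 < degAt k (component f i) := by
    obtain ⟨j, hj⟩ := exists_degAt_component_ne_zero k f
    exact (Nat.pos_of_ne_zero hj).trans_le (hmax j)
  have h1 := hmax (i + 1)
  have h2 := hmax (i + 2)
  have hrel := component_relation f i
  have hX := component_ne_zero f i
  have hY := component_ne_zero f (i + 1)
  have hZ := component_ne_zero f (i + 2)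
  set X := component f i
  set Y := component f (i + 1)
  set Z := component f (i + 2)
  set a := degAt k X
  have hlin : ∀ {n : ℕ}, a ≤ n → degAt k (algebraMap ℂ _ (![A, B, C] i) * X +
      algebraMap ℂ _ (![A, B, C] (i + 1)) * Y + algebraMap ℂ _ (![A, B, C] (i + 2)) * Z +
      algebraMap ℂ _ D) ≤ n := by
    intro n hn
    refine degAt_add_le_of_le (degAt_add_le_of_le (degAt_add_le_of_le ?_ ?_) ?_) ?_
    · exact (degAt_algebraMap_mul_le k _ _).trans hn
    · exact (degAt_algebraMap_mul_le k _ _).trans (h1.trans hn)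
    · exact (degAt_algebraMap_mul_le k _ _).trans (h2.trans hn)
    · rw [degAt_algebraMap]; omega
  apply le_antisymm
  -- If the largest order exceeds the sum of the others, X² strictly dominates all other terms.
  -- Positivity of a gives a ≤ 2a - 1 for the linear terms.
  · by_contra! hlt
    have hsq : X * X = algebraMap ℂ _ (![A, B, C] i) * X +
        algebraMap ℂ _ (![A, B, C] (i + 1)) * Y + algebraMap ℂ _ (![A, B, C] (i + 2)) * Z +
        algebraMap ℂ _ D - Y * Y - Z * Z - X * (Y * Z) := by
      rw [← hrel]; ring
    have hle : degAt k (X * X) ≤ 2 * a - 1 := by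
      rw [hsq]
      refine degAt_sub_le_of_le (degAt_sub_le_of_le (degAt_sub_le_of_le (hlin ?_) ?_) ?_) ?_
      · omega
      · exact (degAt_mul_le k _ _).trans (by omega)
      · exact (degAt_mul_le k _ _).trans (by omega)
      · exact (degAt_mul_le_of_le le_rfl (degAt_mul_le k _ _)).trans (by omega)
    rw [degAt_mul k hX hX] at hle
    omega
  -- Conversely, all terms other than XYZ have order at most 2a, so XYZ does too.
  · have hprod : X * (Y * Z) = algebraMap ℂ _ (![A, B, C] i) * X +
        algebraMap ℂ _ (![A, B, C] (i + 1)) * Y + algebraMap ℂ _ (![A, B, C] (i + 2)) * Z +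
        algebraMap ℂ _ D - Y * Y - Z * Z - X * X := by
      rw [← hrel]; ring
    have hle : degAt k (X * (Y * Z)) ≤ 2 * a := by
      rw [hprod]
      refine degAt_sub_le_of_le (degAt_sub_le_of_le (degAt_sub_le_of_le (hlin ?_) ?_) ?_) ?_
      · omega
      · exact (degAt_mul_le k _ _).trans (by omega)
      · exact (degAt_mul_le k _ _).trans (by omega)
      · exact (degAt_mul_le k _ _).trans (by omega)
    rw [degAt_mul k hX (mul_ne_zero hY hZ), degAt_mul k hY hZ] at hle
    omega

/-- The old and new components are the two roots of the equation viewed as a quadratic in X, so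
their product is Y² + Z² plus terms of degree at most one in Y and Z. If the order of X is the sum
of two positive orders, it exceeds both of them and must drop. -/
theorem degAt_component_involution_mul (k : Fin 3) (f : polyAut A B C D) (i : Fin 3) :
    degAt k (component (involution A B C D i * f) i) + degAt k (component f i) ≤
      2 * max (degAt k (component f (i + 1))) (degAt k (component f (i + 2))) := by
  have hX' := component_ne_zero (involution A B C D i * f) i
  rw [← degAt_mul k hX' (component_ne_zero f i)]
  have hrel := component_relation f i
  rw [component_involution_mul_self]
  set X := component f i
  set Y := component f (i + 1)
  set Z := component f (i + 2)
  set n := max (degAt k Y) (degAt k Z) with hn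
  have hY : degAt k Y ≤ n := le_max_left _ _
  have hZ : degAt k Z ≤ n := le_max_right _ _
  have hprod : (algebraMap ℂ _ (![A, B, C] i) - X - Y * Z) * X = Y * Y + Z * Z -
      algebraMap ℂ _ (![A, B, C] (i + 1)) * Y - algebraMap ℂ _ (![A, B, C] (i + 2)) * Z -
      algebraMap ℂ _ D := by
    linear_combination -hrel
  rw [hprod]
  refine degAt_sub_le_of_le (degAt_sub_le_of_le (degAt_sub_le_of_le
    (degAt_add_le_of_le ?_ ?_) ?_) ?_) ?_
  · exact (degAt_mul_le k _ _).trans (by omega)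
  · exact (degAt_mul_le k _ _).trans (by omega)
  · exact (degAt_algebraMap_mul_le k _ _).trans (by omega)
  · exact (degAt_algebraMap_mul_le k _ _).trans (by omega)
  · simp [degAt_algebraMap]

/-- Components of degree zero along a line at infinity are affine functions of the corresponding
coordinate. -/
theorem exists_component_eq_linear {k l : Fin 3} {f : polyAut A B C D}
    (h : degAt k (component f l) = 0) : ∃ κ μ : ℂ, κ ≠ 0 ∧
      component f l = algebraMap ℂ _ κ * coordFun k + algebraMap ℂ _ μ := by
  obtain ⟨p, hp⟩ := degAt_eq_zero_iff.mp h
  set g := pullback f⁻¹ (coordFun k : polyFun A B C D) with hg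
  have hpg : coordFun l = aeval g p := by
    rw [hg, aeval_algHom_apply, ← hp, component, pullback_inv_pullback]
  have hdeg : p.degree ≠ 0 := by
    intro hdeg
    rw [eq_C_of_degree_eq_zero hdeg, aeval_C] at hpg
    have := degAt_coordFun_of_ne (A := A) (B := B) (C := C) (D := D)
      (fin_three_add_one_ne l).symm
    rw [hpg, degAt_algebraMap] at this
    exact zero_ne_one this
  -- Here `coordFun l = p(g)`. Splitting off a linear factor of p writes `coordFun l` as a product
  -- containing g - r. Its order along the line of index `l` is zero and orders add, so g - r is a
  -- polynomial s in `coordFun l`; then p ∘ (s + r) = X and p has degree one.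
  obtain ⟨r, hr⟩ := IsAlgClosed.exists_root p hdeg
  obtain ⟨q, rfl⟩ := dvd_iff_isRoot.mpr hr
  have hfac : (coordFun l : polyFun A B C D) = (g - algebraMap ℂ _ r) * aeval g q := by
    rw [hpg]; simp
  have hne := coordFun_ne_zero (A := A) (B := B) (C := C) (D := D) l
  rw [hfac] at hne
  have h0 := degAt_coordFun_self (A := A) (B := B) (C := C) (D := D) l
  rw [hfac, degAt_mul l (left_ne_zero_of_mul hne) (right_ne_zero_of_mul hne)] at h0
  obtain ⟨s, hs⟩ := degAt_eq_zero_iff.mp (Nat.eq_zero_of_add_eq_zero_right h0)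
  have hcomp : ((X - Polynomial.C r) * q).comp (s + Polynomial.C r) = X := by
    apply aeval_coordFun_injective (A := A) (B := B) (C := C) (D := D) l
    rw [aeval_comp, map_add, ← hs, aeval_C, sub_add_cancel, ← hpg, aeval_X]
  have hnat := congrArg natDegree hcomp
  rw [natDegree_comp, natDegree_X] at hnat
  obtain ⟨κ, hκ, μ, hμ⟩ := natDegree_eq_one.mp (Nat.eq_one_of_mul_eq_one_right hnat)
  refine ⟨κ, μ, hκ, ?_⟩
  rw [hp, ← hμ]
  simp

theorem involution_mem (i : Fin 3) : involution A B C D i ∈ involutionGroup A B C D :=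
  Subgroup.subset_closure (Set.mem_range_self i)

/-- Reduction of an automorphism by the involutions, without changing the components which are
already reduced. -/
theorem exists_reduction (k : Fin 3) (J : Set (Fin 3)) (n : ℕ) : ∀ f : polyAut A B C D,
    ∑ j, degAt k (component f j) = n → (∀ j ∈ J, degAt k (component f j) = 1) →
    ∃ a ∈ involutionGroup A B C D, (∀ j ∈ J, component (a * f) j = component f j) ∧
      ∃ l, l ∉ J ∧ degAt k (component (a * f) l) = 0 := by
  induction n using Nat.strong_induction_on with
  | _ n ih =>
    intro f hn hJ
    by_cases hz : ∃ l, degAt k (component f l) = 0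
    · obtain ⟨l, hl⟩ := hz
      refine ⟨1, one_mem _, fun j _ => by rw [one_mul], l, fun hlJ => ?_, by rwa [one_mul]⟩
      rw [hJ l hlJ] at hl
      exact one_ne_zero hl
    · push Not at hz
      obtain ⟨i, -, hi⟩ := Finset.exists_max_image Finset.univ
        (fun j => degAt k (component f j)) Finset.univ_nonempty
      have hsum := degAt_component_eq_add k f (i := i) (fun j => hi j (Finset.mem_univ j))
      have h1 := hz (i + 1)
      have h2 := hz (i + 2)
      -- The maximal order is a sum of two positive integers, hence at least 2, while protected
      -- components have order 1.
      have hiJ : i ∉ J := by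
        intro hiJ
        have := hJ i hiJ
        omega
      have hstep := degAt_component_involution_mul k f i
      have hkeep : ∀ j, j ≠ i → component (involution A B C D i * f) j = component f j :=
        fun j hj => component_involution_mul_of_ne f hj
      have hlt : ∑ j, degAt k (component (involution A B C D i * f) j) < n := by
        rw [← hn]
        refine Finset.sum_lt_sum (fun j _ => ?_) ⟨i, Finset.mem_univ i, ?_⟩
        · by_cases hj : j = i
          · subst hj
            omega
          · rw [hkeep j hj]
        · omega
      have hJne : ∀ j ∈ J, j ≠ i := fun j hj hji => hiJ (hji ▸ hj)
      obtain ⟨a, ha, haJ, l, hl, hal⟩ := ih _ hlt (involution A B C D i * f) rfl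
        (fun j hj => by rw [hkeep j (hJne j hj)]; exact hJ j hj)
      refine ⟨a * involution A B C D i, mul_mem ha (involution_mem i), fun j hj => ?_, l, hl, ?_⟩
      · rw [mul_assoc, haJ j hj, hkeep j (hJne j hj)]
      · rwa [mul_assoc]

/-! Affine automorphisms -/

/-- No non-zero quadratic polynomial without constraint on the coordinates vanishes on the
surface. -/
theorem eq_zero_of_quadratic_vanishing {α₀ α₁ α₂ β₀ β₁ β₂ γ₀ γ₁ γ₂ ε : ℂ}
    (h : ∀ p : surface A B C D, α₀ * p.1 0 ^ 2 + α₁ * p.1 1 ^ 2 + α₂ * p.1 2 ^ 2 +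
      β₀ * (p.1 1 * p.1 2) + β₁ * (p.1 2 * p.1 0) + β₂ * (p.1 0 * p.1 1) +
      γ₀ * p.1 0 + γ₁ * p.1 1 + γ₂ * p.1 2 + ε = 0) :
    (α₀ = 0 ∧ α₁ = 0 ∧ α₂ = 0) ∧ (β₀ = 0 ∧ β₁ = 0 ∧ β₂ = 0) ∧
      (γ₀ = 0 ∧ γ₁ = 0 ∧ γ₂ = 0) := by
  let c : ℂ → ℂ[X][X] := fun t => Polynomial.C (Polynomial.C t)
  let x : ℂ[X][X] := Polynomial.C X
  -- The normal form of the quadratic polynomial, with the square of the last coordinate eliminated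
  -- by the equation; it must vanish identically.
  let q : CubicRing (![A, B, C] 0) (![A, B, C] (0 + 1)) (![A, B, C] (0 + 2)) D :=
    ⟨c α₀ * x ^ 2 + c α₁ * X ^ 2 + c β₂ * (x * X) + c γ₀ * x + c γ₁ * X + c ε +
      c α₂ * (c D + c A * x + c B * X - x ^ 2 - X ^ 2),
      c β₀ * X + c β₁ * x + c γ₂ + c α₂ * (c C - x * X)⟩
  have hq : q = 0 := by
    apply evalSurface_injective (A := A) (B := B) (C := C) (D := D) 0
    rw [map_zero]
    funext p
    have hp := p.2
    simp only [surface, Set.mem_ofPred_eq] at hp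
    rw [evalSurface_apply]
    simp [q, c, x, evalEval]
    linear_combination h p - α₂ * hp
  have hre : ∀ u v : ℂ, α₀ * u ^ 2 + α₁ * v ^ 2 + β₂ * (u * v) + γ₀ * u + γ₁ * v + ε +
      α₂ * (D + A * u + B * v - u ^ 2 - v ^ 2) = 0 := by
    intro u v
    have := congrArg (fun q : CubicRing _ _ _ _ => q.re.evalEval u v) hq
    simpa [q, c, x, evalEval, mul_comm v u] using this
  have him : ∀ u v : ℂ, β₀ * v + β₁ * u + γ₂ + α₂ * (C - u * v) = 0 := by
    intro u v
    have := congrArg (fun q : CubicRing _ _ _ _ => q.im.evalEval u v) hq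
    simpa [q, c, x, evalEval, mul_comm v u] using this
  have hα₂ : α₂ = 0 := by
    linear_combination him 1 0 + him 0 1 - him 1 1 - him 0 0
  subst hα₂
  have hγ₂ : γ₂ = 0 := by linear_combination him 0 0
  have hβ₀ : β₀ = 0 := by linear_combination him 0 1 - him 0 0
  have hβ₁ : β₁ = 0 := by linear_combination him 1 0 - him 0 0
  have hα₀ : α₀ = 0 := by linear_combination (hre 1 0 + hre (-1) 0) / 2 - hre 0 0
  have hα₁ : α₁ = 0 := by linear_combination (hre 0 1 + hre 0 (-1)) / 2 - hre 0 0
  have hγ₀ : γ₀ = 0 := by linear_combination (hre 1 0 - hre (-1) 0) / 2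
  have hγ₁ : γ₁ = 0 := by linear_combination (hre 0 1 - hre 0 (-1)) / 2
  have hβ₂ : β₂ = 0 := by
    linear_combination hre 1 1 - hre 1 0 - hre 0 1 + hre 0 0
  exact ⟨⟨hα₀, hα₁, rfl⟩, ⟨hβ₀, hβ₁, hβ₂⟩, hγ₀, hγ₁, hγ₂⟩

theorem mem_surface_iff_perm {p : Fin 3 → ℂ} (l : Equiv.Perm (Fin 3)) : p ∈ surface A B C D ↔
    p (l 0) ^ 2 + p (l 1) ^ 2 + p (l 2) ^ 2 + p (l 0) * p (l 1) * p (l 2) =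
      ![A, B, C] (l 0) * p (l 0) + ![A, B, C] (l 1) * p (l 1) + ![A, B, C] (l 2) * p (l 2) + D := by
  have h1 := Equiv.sum_comp l (fun j => p j ^ 2)
  have h2 := Equiv.prod_comp l p
  have h3 := Equiv.sum_comp l (fun j => ![A, B, C] j * p j)
  simp only [Fin.sum_univ_three, Fin.prod_univ_three] at h1 h2 h3
  rw [h1, h2, h3]
  simp [surface]

/-- `f` permutes the coordinates and changes some of their signs. -/
structure IsSignedPerm (f : polyAut A B C D) (l : Equiv.Perm (Fin 3)) (κ : Fin 3 → ℂ) : Prop where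
  apply : ∀ p k, ((f : Equiv.Perm (surface A B C D)) p).1 (l k) = κ k * p.1 k
  sq : ∀ k, κ k * κ k = 1
  prod : κ 0 * κ 1 * κ 2 = 1
  coeff : ∀ k, κ k * ![A, B, C] (l k) = ![A, B, C] k

theorem isSignedPerm_of_linear {f : polyAut A B C D} {l : Equiv.Perm (Fin 3)} {κ μ : Fin 3 → ℂ}
    (hκ : ∀ k, κ k ≠ 0)
    (hf : ∀ p k, ((f : Equiv.Perm (surface A B C D)) p).1 (l k) = κ k * p.1 k + μ k) :
    IsSignedPerm f l κ := by
  set K := κ 0 * κ 1 * κ 2 with hK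
  set θ := ![A, B, C] with hθ
  -- Substitute the affine map into the equation and subtract K times the original equation to
  -- cancel the cubic term. The mixed coefficients then give μ = 0; the squares give κᵢ² = K, whence
  -- K³ = K² and K = 1.
  have hvan : ∀ p : surface A B C D,
      (κ 0 ^ 2 - K) * p.1 0 ^ 2 + (κ 1 ^ 2 - K) * p.1 1 ^ 2 + (κ 2 ^ 2 - K) * p.1 2 ^ 2 +
      (κ 1 * κ 2 * μ 0) * (p.1 1 * p.1 2) + (κ 2 * κ 0 * μ 1) * (p.1 2 * p.1 0) +
      (κ 0 * κ 1 * μ 2) * (p.1 0 * p.1 1) +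
      (2 * κ 0 * μ 0 + κ 0 * μ 1 * μ 2 - κ 0 * θ (l 0) + K * A) * p.1 0 +
      (2 * κ 1 * μ 1 + κ 1 * μ 0 * μ 2 - κ 1 * θ (l 1) + K * B) * p.1 1 +
      (2 * κ 2 * μ 2 + κ 2 * μ 0 * μ 1 - κ 2 * θ (l 2) + K * C) * p.1 2 +
      (μ 0 ^ 2 + μ 1 ^ 2 + μ 2 ^ 2 + μ 0 * μ 1 * μ 2 - θ (l 0) * μ 0 - θ (l 1) * μ 1 -
        θ (l 2) * μ 2 - D + K * D) = 0 := by
    intro p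
    have h1 := (mem_surface_iff_perm l).mp ((f : Equiv.Perm (surface A B C D)) p).2
    rw [hf, hf, hf, ← hθ] at h1
    have h2 := p.2
    simp only [surface, Set.mem_ofPred_eq] at h2
    linear_combination h1 - K * h2
  obtain ⟨⟨a0, a1, a2⟩, ⟨b0, b1, b2⟩, c0, c1, c2⟩ := eq_zero_of_quadratic_vanishing hvan
  have hKne : K ≠ 0 := mul_ne_zero (mul_ne_zero (hκ 0) (hκ 1)) (hκ 2)
  have hK1 : K = 1 := by
    have : K ^ 2 * (K - 1) = 0 := by
      have e0 : κ 0 ^ 2 = K := by linear_combination a0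
      have e1 : κ 1 ^ 2 = K := by linear_combination a1
      have e2 : κ 2 ^ 2 = K := by linear_combination a2
      have : K * K * K = K ^ 2 := by
        nth_rewrite 1 [← e0]
        nth_rewrite 1 [← e1]
        nth_rewrite 1 [← e2]
        rw [hK]; ring
      linear_combination this
    have := (mul_eq_zero.mp this).resolve_left (pow_ne_zero 2 hKne)
    linear_combination this
  have m0 : μ 0 = 0 := (mul_eq_zero.mp b0).resolve_left (mul_ne_zero (hκ 1) (hκ 2))
  have m1 : μ 1 = 0 := (mul_eq_zero.mp b1).resolve_left (mul_ne_zero (hκ 2) (hκ 0))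
  have m2 : μ 2 = 0 := (mul_eq_zero.mp b2).resolve_left (mul_ne_zero (hκ 0) (hκ 1))
  rw [m0, m1, m2, hK1] at c0 c1 c2
  rw [hK1] at a0 a1 a2
  refine ⟨fun p k => ?_, fun k => ?_, hK1, fun k => ?_⟩
  · rw [hf]
    fin_cases k <;> simp [m0, m1, m2]
  · fin_cases k
    · change κ 0 * κ 0 = 1
      linear_combination a0
    · change κ 1 * κ 1 = 1
      linear_combination a1
    · change κ 2 * κ 2 = 1
      linear_combination a2
  · rw [← hθ]
    fin_cases k
    · change κ 0 * θ (l 0) = A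
      linear_combination -c0
    · change κ 1 * θ (l 1) = B
      linear_combination -c1
    · change κ 2 * θ (l 2) = C
      linear_combination -c2

/-- Up to the group `𝒜`, every automorphism permutes the coordinates and changes some signs. -/
theorem exists_isSignedPerm (f : polyAut A B C D) : ∃ a ∈ involutionGroup A B C D,
    ∃ l κ, IsSignedPerm (a * f) l κ := by
  -- One reduction for each line at infinity; each produces a component affine in a new coordinate
  -- and leaves the previous ones unchanged.
  obtain ⟨a₀, ha₀, -, l₀, -, hl₀⟩ := exists_reduction 0 ∅ _ f rfl (by simp)
  obtain ⟨κ₀, μ₀, hκ₀, h₀⟩ := exists_component_eq_linear hl₀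
  obtain ⟨a₁, ha₁, keep₁, l₁, hne₁, hl₁⟩ := exists_reduction 1 {l₀} _ (a₀ * f) rfl (by
    rintro _ rfl
    rw [h₀, degAt_linear (by decide) hκ₀])
  obtain ⟨κ₁, μ₁, hκ₁, h₁⟩ := exists_component_eq_linear hl₁
  rw [← keep₁ l₀ rfl] at h₀
  obtain ⟨a₂, ha₂, keep₂, l₂, hne₂, hl₂⟩ := exists_reduction 2 {l₀, l₁} _ (a₁ * (a₀ * f)) rfl (by
    rintro _ (rfl | rfl)
    · rw [h₀, degAt_linear (by decide) hκ₀]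
    · rw [h₁, degAt_linear (by decide) hκ₁])
  obtain ⟨κ₂, μ₂, hκ₂, h₂⟩ := exists_component_eq_linear hl₂
  rw [← keep₂ l₀ (by simp)] at h₀
  rw [← keep₂ l₁ (by simp)] at h₁
  simp only [Set.mem_singleton_iff, Set.mem_insert_iff, not_or] at hne₁ hne₂
  have hinj : Function.Injective ![l₀, l₁, l₂] := by
    intro i j hij
    fin_cases i <;> fin_cases j <;> simp at hij ⊢ <;> first
      | exact hne₁ hij | exact hne₁ hij.symm | exact hne₂.1 hij | exact hne₂.1 hij.symm
      | exact hne₂.2 hij | exact hne₂.2 hij.symm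
  refine ⟨a₂ * a₁ * a₀, mul_mem (mul_mem ha₂ ha₁) ha₀,
    Equiv.ofBijective _ (Finite.injective_iff_bijective.mp hinj), ![κ₀, κ₁, κ₂],
    isSignedPerm_of_linear (μ := ![μ₀, μ₁, μ₂]) (fun k => ?_) (fun p k => ?_)⟩
  · fin_cases k
    · exact hκ₀
    · exact hκ₁
    · exact hκ₂
  · rw [mul_assoc, mul_assoc, Equiv.ofBijective_apply, ← component_apply]
    fin_cases k
    · exact congrArg (fun g : polyFun A B C D => g.1 p) h₀
    · exact congrArg (fun g : polyFun A B C D => g.1 p) h₁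
    · exact congrArg (fun g : polyFun A B C D => g.1 p) h₂

/-! ### Normality, index and the generic case -/

theorem prod_others_perm (l : Equiv.Perm (Fin 3)) (k : Fin 3) (q : Fin 3 → ℂ) :
    q (l k + 1) * q (l k + 2) = q (l (k + 1)) * q (l (k + 2)) := by
  have h1 : l (k + 1) ≠ l k := fun h => fin_three_add_one_ne k (l.injective h)
  have h2 : l (k + 2) ≠ l k := fun h => fin_three_add_two_ne k (l.injective h)
  have h12 : l (k + 1) ≠ l (k + 2) := by simp
  rcases fin_three_cases h1 with e1 | e1 <;> rcases fin_three_cases h2 with e2 | e2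
  · exact absurd (e1.trans e2.symm) h12
  · rw [e1, e2]
  · rw [e1, e2, mul_comm]
  · exact absurd (e1.trans e2.symm) h12

namespace IsSignedPerm

variable {f : polyAut A B C D} {l : Equiv.Perm (Fin 3)} {κ : Fin 3 → ℂ}

theorem mul_others (h : IsSignedPerm f l κ) (k : Fin 3) : κ (k + 1) * κ (k + 2) = κ k := by
  have hp := h.prod
  fin_cases k
  · change κ 1 * κ 2 = κ 0
    linear_combination κ 0 * hp - κ 1 * κ 2 * h.sq 0
  · change κ 2 * κ 0 = κ 1
    linear_combination κ 1 * hp - κ 2 * κ 0 * h.sq 1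
  · change κ 0 * κ 1 = κ 2
    linear_combination κ 2 * hp - κ 0 * κ 1 * h.sq 2

/-- Each involution swaps the two points with given values of the other two coordinates, so a signed
permutation of coordinates permutes the involutions by conjugation. In formulas, this uses that each
sign is the product of the other two. -/
theorem mul_involution (h : IsSignedPerm f l κ) (k : Fin 3) :
    f * involution A B C D k = involution A B C D (l k) * f := by
  refine Subtype.ext (Equiv.ext fun p => Subtype.ext (funext fun m => ?_))
  obtain ⟨j, rfl⟩ := l.surjective m
  change ((f : Equiv.Perm (surface A B C D))
    ((involution A B C D k : Equiv.Perm (surface A B C D)) p)).1 (l j) =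
    ((involution A B C D (l k) : Equiv.Perm (surface A B C D))
      ((f : Equiv.Perm (surface A B C D)) p)).1 (l j)
  rw [h.apply]
  by_cases hj : j = k
  · subst hj
    rw [involution_apply_self, involution_apply_self, prod_others_perm, h.apply, h.apply, h.apply,
      ← h.coeff j]
    linear_combination ![A, B, C] (l j) * h.sq j + p.1 (j + 1) * p.1 (j + 2) * h.mul_others j
  · rw [involution_apply_of_ne hj, involution_apply_of_ne (fun e => hj (l.injective e)), h.apply]

theorem conj_mem (h : IsSignedPerm f l κ) {n : polyAut A B C D}
    (hn : n ∈ involutionGroup A B C D) : f * n * f⁻¹ ∈ involutionGroup A B C D := by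
  induction hn using Subgroup.closure_induction with
  | mem x hx =>
    obtain ⟨k, rfl⟩ := hx
    rw [h.mul_involution, mul_inv_cancel_right]
    exact involution_mem _
  | one => simp
  | mul x y _ _ hx hy =>
    have := mul_mem hx hy
    rwa [show f * x * f⁻¹ * (f * y * f⁻¹) = f * (x * y) * f⁻¹ by group] at this
  | inv x _ hx =>
    have := inv_mem hx
    rwa [show (f * x * f⁻¹)⁻¹ = f * x⁻¹ * f⁻¹ by group] at this

theorem eq_of_same {f' : polyAut A B C D} (h : IsSignedPerm f l κ) (h' : IsSignedPerm f' l κ) :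
    f = f' := by
  refine Subtype.ext (Equiv.ext fun p => Subtype.ext (funext fun m => ?_))
  obtain ⟨j, rfl⟩ := l.surjective m
  rw [h.apply, h'.apply]

theorem sign_cases (h : IsSignedPerm f l κ) (k : Fin 3) : κ k = 1 ∨ κ k = -1 :=
  mul_self_eq_one_iff.mp (h.sq k)

/-- Squaring the relation between coefficients removes the signs, so distinct squares force the
permutation to be trivial; non-zero coefficients then force the signs to be 1. -/
theorem eq_one (h : IsSignedPerm f l κ) (hne : ∀ k, ![A, B, C] k ≠ 0)
    (hsq : ∀ j k, ![A, B, C] j ^ 2 = ![A, B, C] k ^ 2 → j = k) : f = 1 := by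
  have hl : ∀ k, l k = k := by
    intro k
    apply hsq
    have hk := h.coeff k
    rw [← hk]
    linear_combination -(![A, B, C] (l k)) ^ 2 * h.sq k
  refine Subtype.ext (Equiv.ext fun p => Subtype.ext (funext fun m => ?_))
  have hm := h.apply p m
  have hc := h.coeff m
  rw [hl] at hm hc
  rw [hm, mul_eq_right₀ (hne m) |>.mp hc, one_mul]
  rfl

end IsSignedPerm

/-- Every automorphism is a signed permutation up to a factor in `𝒜`, and signed permutations
normalise `𝒜`. -/
instance involutionGroup_normal (A B C D : ℂ) : (involutionGroup A B C D).Normal where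
  conj_mem n hn f := by
    obtain ⟨a, ha, l, κ, h⟩ := exists_isSignedPerm f
    have := mul_mem (mul_mem (inv_mem ha) (h.conj_mem hn)) ha
    rwa [show a⁻¹ * (a * f * n * (a * f)⁻¹) * a = f * n * f⁻¹ by group] at this

open Classical in
theorem index_involutionGroup (A B C D : ℂ) : (involutionGroup A B C D).index ≠ 0 ∧
    (involutionGroup A B C D).index ≤ 24 := by
  choose a ha l κ h using exists_isSignedPerm (A := A) (B := B) (C := C) (D := D)
  -- The third sign is the product of the first two, which leaves 6 · 2 · 2 = 24 codes.
  let code : polyAut A B C D ⧸ involutionGroup A B C D → Equiv.Perm (Fin 3) × Bool × Bool :=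
    fun x => (l x.out, decide (κ x.out 0 = 1), decide (κ x.out 1 = 1))
  have hcode : Function.Injective code := by
    intro x y hxy
    simp only [code, Prod.mk.injEq, decide_eq_decide] at hxy
    obtain ⟨hl, h0, h1⟩ := hxy
    have hx := h x.out
    have hy := h y.out
    have key : ∀ k, (κ x.out k = 1 ↔ κ y.out k = 1) → κ x.out k = κ y.out k := by
      intro k hk
      rcases hx.sign_cases k with e | e <;> rcases hy.sign_cases k with e' | e'
      · rw [e, e']
      · rw [e, hk.mp e]
      · rw [e', hk.mpr e']
      · rw [e, e']
    have hκ : κ x.out = κ y.out := by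
      funext k
      fin_cases k
      · exact key 0 h0
      · exact key 1 h1
      · have e1 := hx.mul_others 2
        have e2 := hy.mul_others 2
        change κ x.out 0 * κ x.out 1 = _ at e1
        change κ y.out 0 * κ y.out 1 = _ at e2
        change κ x.out 2 = κ y.out 2
        rw [← e1, ← e2, key 0 h0, key 1 h1]
    rw [← hl, ← hκ] at hy
    have heq := hx.eq_of_same hy
    rw [← x.out_eq', ← y.out_eq']
    have hq : ∀ z : polyAut A B C D, (QuotientGroup.mk (a z * z) : polyAut A B C D ⧸
        involutionGroup A B C D) = QuotientGroup.mk z := by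
      intro z
      rw [QuotientGroup.mk_mul, (QuotientGroup.eq_one_iff _).mpr (ha z), one_mul]
    have := congrArg (QuotientGroup.mk (s := involutionGroup A B C D)) heq
    rwa [hq, hq] at this
  have : Finite (polyAut A B C D ⧸ involutionGroup A B C D) := Finite.of_injective _ hcode
  refine ⟨Subgroup.index_ne_zero_of_finite, ?_⟩
  have hle := Nat.card_le_card_of_injective _ hcode
  have hcard : Nat.card (Equiv.Perm (Fin 3) × Bool × Bool) = 24 := by
    simp [Nat.card_eq_fintype_card, Fintype.card_perm, Nat.factorial]
  rw [hcard] at hle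
  exact hle

theorem involutionGroup_eq_top (hne : ∀ k, ![A, B, C] k ≠ 0)
    (hsq : ∀ j k, ![A, B, C] j ^ 2 = ![A, B, C] k ^ 2 → j = k) : involutionGroup A B C D = ⊤ := by
  rw [Subgroup.eq_top_iff']
  intro f
  obtain ⟨a, ha, l, κ, h⟩ := exists_isSignedPerm f
  rw [eq_inv_of_mul_eq_one_right (h.eq_one hne hsq)]
  exact inv_mem ha

theorem exists_generic_polynomial : ∃ P : MvPolynomial (Fin 4) ℂ, P ≠ 0 ∧
    ∀ A B C D : ℂ, MvPolynomial.eval ![A, B, C, D] P ≠ 0 → involutionGroup A B C D = ⊤ := by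
  -- Non-vanishing means that A, B, C are non-zero with pairwise distinct squares; D plays no role.
  open MvPolynomial in
  let P : MvPolynomial (Fin 4) ℂ := X 0 * X 1 * X 2 * (X 0 ^ 2 - X 1 ^ 2) * (X 1 ^ 2 - X 2 ^ 2) *
    (X 2 ^ 2 - X 0 ^ 2)
  have hP : ∀ A B C D : ℂ, MvPolynomial.eval ![A, B, C, D] P =
      A * B * C * (A ^ 2 - B ^ 2) * (B ^ 2 - C ^ 2) * (C ^ 2 - A ^ 2) := by
    intro A B C D
    simp [P]
  refine ⟨P, fun h0 => ?_, fun A B C D h => ?_⟩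
  · have := hP 1 2 3 0
    rw [h0, map_zero] at this
    norm_num at this
  · rw [hP] at h
    simp only [mul_ne_zero_iff, sub_ne_zero] at h
    obtain ⟨⟨⟨⟨⟨hA, hB⟩, hC⟩, hAB⟩, hBC⟩, hCA⟩ := h
    apply involutionGroup_eq_top
    · intro k
      fin_cases k
      · exact hA
      · exact hB
      · exact hC
    · intro j k hjk
      fin_cases j <;> fin_cases k <;> simp at hjk ⊢ <;> first
        | exact hAB hjk | exact hBC hjk | exact hCA hjk
        | exact hAB hjk.symm | exact hBC hjk.symm | exact hCA hjk.symm

end CubicSurface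

theorem theoremA :
    ∃ Ψ : CubicSurface.GammaTwoStar →* CubicSurface.Out CubicSurface.SpherePi1,
      CubicSurface.IsModularMorphism Ψ ∧
      (∀ A B C D : ℂ,
        (∃ e : CubicSurface.FreeProductZ2 ≃* CubicSurface.involutionGroup A B C D,
          ∀ i : Fin 3, (e (CubicSurface.freeGen i) : CubicSurface.polyAut A B C D)
            = CubicSurface.involution A B C D i) ∧
        (∃ Θ : CubicSurface.GammaTwoStar →* CubicSurface.polyAut A B C D,
          CubicSurface.IsInducedAction A B C D Ψ Θ ∧
          Function.Injective Θ ∧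
          Θ.range = CubicSurface.involutionGroup A B C D) ∧
        (CubicSurface.involutionGroup A B C D).Normal ∧
        (CubicSurface.involutionGroup A B C D).index ≠ 0 ∧
        (CubicSurface.involutionGroup A B C D).index ≤ 24) ∧
      (∃ P : MvPolynomial (Fin 4) ℂ, P ≠ 0 ∧
        ∀ A B C D : ℂ, MvPolynomial.eval ![A, B, C, D] P ≠ 0 →
          CubicSurface.involutionGroup A B C D = ⊤) := by
  refine ⟨CubicSurface.modularMorphism, CubicSurface.isModularMorphism_modularMorphism,
    fun A B C D => ⟨⟨CubicSurface.freeEquivInvolutionGroup A B C D,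
      CubicSurface.freeEquivInvolutionGroup_freeGen A B C D⟩,
      ⟨CubicSurface.modularAction A B C D, CubicSurface.isInducedAction_modularAction A B C D,
        CubicSurface.modularAction_injective A B C D,
        CubicSurface.range_modularAction A B C D⟩,
      CubicSurface.involutionGroup_normal A B C D, CubicSurface.index_involutionGroup A B C D⟩,
    CubicSurface.exists_generic_polynomial⟩
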